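/- Let $1\le T<N$ and $M\ge 2$ be integers and let $\mathbb F$ be a finite field. Setting: $M$ messages $W^1,\dots,W^M\in\mathbb F^L$ are replicated ($K=1$) on $N$ servers. A PIR scheme consists, for each index $m$ of the desired message, of a random tuple of queries, one for each server; each server answers its query by a string of symbols of $\mathbb F$ that is a function of the query and of the database. It is an $(N,1,T,M)$-PIR scheme if the queries and answers determine $W^m$ (correctness), and the joint law of the queries sent to any $T$ servers does not depend on $m$ ($T$-privacy). Its rate is $L$ divided by the expected number of downloaded symbols. A scheme is linear if each server receives a list of vectors $q\in\mathbb F^{ML}$ and answers each by the inner product $\langle (W^1,\dots,W^M),q\rangle$; the number of downloaded symbols is then the number of queries. Let $G\in\mathbb F^{N\times T}$ be the generator of a $T$-threshold linear secret sharing scheme, i.e. any $T$ rows of $G$ are linearly independent (an $(N,T)$-MDS code). It gives a scheme on messages of length $N-T$: for $\rho_1,\dots,\rho_T\in\mathbb F^{M(N-T)}$ uniformly random put $q_j=\sum_t G_{jt}\rho_t$, and send $q_j$ to server $j\le T$ and $q_j+e_{j-T}$ to server $j>T$, where $e_1,\dots,e_{N-T}$ are the standard basis vectors of the desired message. This scheme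 is a one-shot scheme of codimension $T$: any $T$ queries are uniform and independent, the responses to the information parts are linearly independent, and the noise responses of servers $j>T$ are linear combinations of those of the first $T$ servers. Refining and lifting it to $M$ messages of length $L=N^{M-1}$ means the following. The symbolic matrix $S_2$ is the row $(1,\dots,1,2,\dots,2)$ with $T$ ones and $N-T$ twos; $S_{k+1}$ consists of $S_k$, its first $T-1$ cyclic shifts to the left, and for each entry $b$ of $S_k$ with value $k$ one more row, which is $0$ in the $T$ columns containing the copies of $b$ in these shifts and $k+1$ in the other columns. The row $S_2$ is a block; the copies of the blocks of $S_k$ are blocks of $S_{k+1}$, and so is, for each $b$ as above, the set of the $T$ copies of $b$ and the $N-T$ nonzero entries of its new row. So a block has one entry in each column, $T$ of them with some value $l$ (its level) and $N-T$ with value $l+1$. An entry $k$ of $S_M$ in column $j$ stands for one query to server $j$ for each set $U$ of $k$ messages. If message $m$ is desired, this query is the sum of a vector $a\in\mathbb F^L$ in the coordinates of message $m$ (if $m\in U$) and of interference in the coordinates of the messages in $U'=U\setminus\{m\}$; if $U'\neq\emptyset$, the interference in the coordinates of $m'\in U'$ is $\sum_t G_{jt}w_t$, where $w_1,\dots,w_T\in\mathbb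 F^L$ depend on $m'$, on $U'$ and on the block of level $|U'|$ that contains the entry. The vectors $a$ are uniformly random subject to being linearly independent, and so are, for each $m'\ne m$, all the vectors $w$ for $m'$; these families are independent for different messages. Then this refined and lifted scheme $\mathcal Q$ is an $(N,1,T,M)$-PIR scheme with rate $$R_{\mathcal Q}=\frac{(N-T)N^{M-1}}{N^M-T^M}.$$ This rate is capacity-achieving: it is the largest rate of any $(N,1,T,M)$-PIR scheme with symbols in $\mathbb F$, linear or not, for messages of any length $L\ge1$. Moreover $\mathcal Q$ has fewer queries than the Sun–Jafar scheme, which has message length $N^M$ and sends to each server, for each set of $k\ge1$ messages, $T^{M-k}(N-T)^{k-1}$ queries that are sums of one vector for each of the $k$ messages. -/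

import Mathlib

open scoped ENNReal Classical

noncomputable section

namespace PIR

/-! ### Private information retrieval from replicated data -/

/-- The contents of a database of `M` messages, each a vector of `L` symbols of `F`; with replicated
data every server stores the whole database. -/
abbrev Database (F : Type) (M L : ℕ) : Type := Fin M → Fin L → F

/-- A linear query is a coefficient vector with one coefficient for every symbol of the database. -/
abbrev LinQuery (F : Type) (M L : ℕ) : Type := Fin M → Fin L → F

/-- The response `⟨D, q⟩` of a server to a linear query. -/
def response {F : Type} [Field F] {M L : ℕ} (D : Database F M L) (q : LinQuery F M L) : F :=
  ∑ m, ∑ i, D m i * q m i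

/-- An arbitrary (not necessarily linear) retrieval scheme for `M` replicated messages of `L` symbols
on `N` servers. To retrieve message `m` the user draws a tuple of queries, one for each server, from
the law `law m`. Server `j` answers the query `q` by a string of symbols, whose positions are the
elements of `Pos j q`, and which is a function of the query and of the database. -/
structure Scheme (F : Type) (N M L : ℕ) where
  Query : Fin N → Type
  law : Fin M → PMF (∀ j, Query j)
  Pos : ∀ j, Query j → Type
  finPos : ∀ j q, Fintype (Pos j q)
  answer : ∀ j (q : Query j), Database F M L → Pos j q → F

namespace Scheme

variable {F : Type} {N M L : ℕ}

/-- Correctness: the queries sent and the answers received determine the desired message. -/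
def Correct (P : Scheme F N M L) : Prop :=
  ∀ m, ∀ q ∈ (P.law m).support, ∀ D D' : Database F M L,
    (∀ j, P.answer j (q j) D = P.answer j (q j) D') → D m = D' m

/-- `T`-privacy: the queries seen by any `T` servers are independent of the index of the desired
message, that is, their joint law does not depend on that index. -/
def Private (P : Scheme F N M L) (T : ℕ) : Prop :=
  ∀ J : Finset (Fin N), J.card = T → ∀ m m' : Fin M,
    (P.law m).map (fun q => fun j : J => q j) = (P.law m').map (fun q => fun j : J => q j)

/-- An `(N, 1, T, M)`-PIR scheme: correctness and `T`-privacy on replicated data. -/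
def IsPIR (P : Scheme F N M L) (T : ℕ) : Prop := P.Correct ∧ P.Private T

/-- The number of symbols downloaded when the tuple of queries is `q`. -/
def downloadOf (P : Scheme F N M L) (q : ∀ j, P.Query j) : ℕ :=
  ∑ j, @Fintype.card (P.Pos j (q j)) (P.finPos j (q j))

/-- The expected number of downloaded symbols (for the worst desired message; for a `T`-private
scheme with `1 ≤ T` it is the same for all of them). -/
def download (P : Scheme F N M L) : ℝ≥0∞ :=
  ⨆ m, ∑' q, P.law m q * (P.downloadOf q : ℝ≥0∞)

/-- The rate of a scheme: message length over download cost. -/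
def rate (P : Scheme F N M L) : ℝ := ((L : ℝ≥0∞) / P.download).toReal

end Scheme

/-- The rates of all `(N, 1, T, M)`-PIR schemes with symbols in `F`, linear or not, for messages of
any positive length. The PIR capacity is the supremum of this set. -/
def achievableRates (F : Type) (N T M : ℕ) : Set ℝ :=
  {R | ∃ L : ℕ, 1 ≤ L ∧ ∃ P : Scheme F N M L, P.IsPIR T ∧ P.rate = R}

/-- A linear scheme: server `j` is sent linear queries, labelled by the elements of `Idx j`, and
answers each of them by its inner product with the database. -/
structure LinearScheme (F : Type) (N M L : ℕ) where
  Idx : Fin N → Type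
  finIdx : ∀ j, Fintype (Idx j)
  law : Fin M → PMF (∀ j, Idx j → LinQuery F M L)

namespace LinearScheme

variable {F : Type} {N M L : ℕ}

/-- A linear scheme is a scheme. -/
def toScheme [Field F] (Q : LinearScheme F N M L) : Scheme F N M L where
  Query j := Q.Idx j → LinQuery F M L
  law := Q.law
  Pos j _ := Q.Idx j
  finPos j _ := Q.finIdx j
  answer _ q D := fun x => response D (q x)

/-- A linear `(N, 1, T, M)`-PIR scheme. -/
def IsPIR [Field F] (Q : LinearScheme F N M L) (T : ℕ) : Prop := Q.toScheme.IsPIR T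

/-- The total number of queries. -/
def numQueries (Q : LinearScheme F N M L) : ℕ := ∑ j, @Fintype.card (Q.Idx j) (Q.finIdx j)

/-- The PIR rate of a linear scheme: message length over number of queries. -/
def rate (Q : LinearScheme F N M L) : ℝ := (L : ℝ) / (Q.numQueries : ℝ)

end LinearScheme

/-! ### One-shot schemes and secret sharing -/

/-- One-shot schemes of codimension `r` on replicated data. `law m` is the joint law of the queries,
one for each server, when message `m` is desired. The queries are noise `q j` for the first `r`
servers and noise plus information `q j + a j` for the others. The `a j` query only message `m` and
have linearly independent responses; any `T` queries are uniform and independent; the noise responses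
of the last servers are linear combinations of those of the first `r` servers. -/
def IsOneShot {F : Type} [Field F] [Fintype F] {N M L : ℕ}
    (law : Fin M → PMF (Fin N → LinQuery F M L)) (T r : ℕ) : Prop :=
  ∀ m, ∃ (noise : PMF (Fin N → LinQuery F M L)) (a : Fin N → LinQuery F M L),
    law m = noise.map (fun q => q + a) ∧
    (∀ j : Fin N, (j : ℕ) < r → a j = 0) ∧
    (∀ (j : Fin N) (m' : Fin M), m' ≠ m → a j m' = 0) ∧
    (∀ J : Finset (Fin N), J.card = T →
      (law m).map (fun q => fun j : J => q j) = PMF.uniformOfFintype (J → LinQuery F M L)) ∧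
    LinearIndependent F
      (fun (j : {j : Fin N // r ≤ (j : ℕ)}) (D : Database F M L) => response D (a j)) ∧
    ∃ α : Fin N → Fin N → F, ∀ q ∈ noise.support, ∀ j : Fin N, r ≤ (j : ℕ) →
      ∀ D : Database F M L,
        response D (q j) = ∑ i ∈ Finset.univ.filter (fun i : Fin N => (i : ℕ) < r), α j i * response D (q i)

/-- A `T`-threshold linear secret sharing scheme for `N` servers over `F`: from `T` uniformly random
elements `ρ` one forms the masks `∑ t, gen j t * ρ t` of the `N` shares. They are the codewords of an
`(N, T)`-MDS code, that is, any `T` rows of the generator are linearly independent (so that any `T`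
masks are uniform and independent, and `T` of them determine the others). -/
structure SecretSharing (F : Type) [Field F] (N T : ℕ) where
  gen : Matrix (Fin N) (Fin T) F
  mds : ∀ J : Finset (Fin N), J.card = T → LinearIndependent F (fun j : J => gen j)

/-- The queries of the one-shot scheme of a secret sharing scheme: messages have `N - T` symbols, the
first `T` servers get masks, and server `T + i` gets a mask plus the `i`-th standard basis vector of the
desired message. -/
def SecretSharing.oneShotLaw {F : Type} [Field F] [Fintype F] {N T : ℕ} (S : SecretSharing F N T)
    (M : ℕ) (m : Fin M) : PMF (Fin N → LinQuery F M (N - T)) :=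
  (PMF.uniformOfFintype (Fin T → LinQuery F M (N - T))).map fun ρ j =>
    (∑ t, S.gen j t • ρ t) +
      if T ≤ (j : ℕ) then Pi.single m (fun i : Fin (N - T) => if (i : ℕ) = (j : ℕ) - T then (1 : F) else 0) else 0

/-! ### Symbolic matrices -/

/-- Move `t` columns to the right, cyclically. -/
def cyc {N : ℕ} (t : ℕ) (j : Fin N) : Fin N := ⟨((j : ℕ) + t) % N, Nat.mod_lt _ j.pos⟩

/-- A matrix of natural numbers with `N` columns. The order of the rows is immaterial, and the rows
are indexed by any finite type. -/
structure SymMatrix (N : ℕ) where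
  Row : Type
  finRow : Fintype Row
  entry : Matrix Row (Fin N) ℕ

attribute [instance] SymMatrix.finRow

/-- The set of entries with value `k`. -/
abbrev SymMatrix.Cell {N : ℕ} (S : SymMatrix N) (k : ℕ) : Type :=
  {b : S.Row × Fin N // S.entry b.1 b.2 = k}

/-- The one-row matrix `(1, …, 1, 2, …, 2)` with `r` ones, of the refined scheme. -/
def refinedMatrix (N r : ℕ) : SymMatrix N where
  Row := Unit
  finRow := inferInstance
  entry := fun _ j => if (j : ℕ) < r then 1 else 2

/-- Lifting of a matrix whose largest entry is `k`. Row `inl (t, i)` is row `i` of the `t`-th shift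
`σ^t S`, whose entry in column `j` is the entry of `S` in column `j + t`. Row `inr b` is the row of `A`
that belongs to the entry `b` with value `k`. The entry `b` occurs in the `t`-th shift in column
`b.2 - t`; row `inr b` vanishes in these `r` columns and is `k + 1` elsewhere. -/
def SymMatrix.lift {N : ℕ} (r k : ℕ) (S : SymMatrix N) : SymMatrix N where
  Row := (Fin r × S.Row) ⊕ S.Cell k
  finRow := inferInstance
  entry := fun x j =>
    match x with
    | Sum.inl (t, i) => S.entry i (cyc t j)
    | Sum.inr b => if ∃ t : Fin r, cyc t j = b.1.2 then 0 else k + 1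

/-- `symMatrix N r k` is the symbolic matrix `S_{k+2}` of codimension `r`. -/
def symMatrix (N r : ℕ) : ℕ → SymMatrix N
  | 0 => refinedMatrix N r
  | k + 1 => (symMatrix N r k).lift r (k + 2)

/-- The decoding blocks of `S_{k+2}`. A block consists of one cell in each column: `r` cells with some
value `l` and `N - r` cells with value `l + 1`. The row of `S_2` is a block; lifting keeps the blocks of
each shifted copy, and creates a block for each entry `b` with the largest value, made of the `r` copies
of `b` and of the nonzero cells of the row of `A` belonging to `b`. -/
def Block (N r : ℕ) : ℕ → Type
  | 0 => Unit
  | k + 1 => (Fin r × Block N r k) ⊕ (symMatrix N r k).Cell (k + 2)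

instance Block.instFinite (N r : ℕ) : ∀ k, Finite (Block N r k)
  | 0 => inferInstanceAs (Finite Unit)
  | k + 1 =>
    haveI := Block.instFinite N r k
    inferInstanceAs (Finite ((Fin r × Block N r k) ⊕ (symMatrix N r k).Cell (k + 2)))

/-- The smaller one of the two values in a block. -/
def Block.level {N r : ℕ} : ∀ {k : ℕ}, Block N r k → ℕ
  | 0, _ => 1
  | _ + 1, Sum.inl (_, g) => Block.level g
  | k + 1, Sum.inr _ => k + 2

/-- The row of the cell of a block in column `j`. -/
def Block.row {N r : ℕ} : ∀ {k : ℕ}, Block N r k → Fin N → (symMatrix N r k).Row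
  | 0, _, _ => ()
  | _ + 1, Sum.inl (t, g), j => Sum.inl (t, Block.row g (cyc t j))
  | _ + 1, Sum.inr b, j =>
    if h : ∃ t : Fin r, cyc t j = b.1.2 then Sum.inl (h.choose, b.1.1) else Sum.inr b

/-! ### The refined and lifted scheme -/

/-- The queries to server `j` for `M` messages: an entry `k` of the symbolic matrix in column `j`
stands for one `k`-query for every set of `k` messages. -/
def QueryIdx (N r M : ℕ) (j : Fin N) : Type :=
  {x : (symMatrix N r (M - 2)).Row × Finset (Fin M) //
    x.2.Nonempty ∧ x.2.card = (symMatrix N r (M - 2)).entry x.1 j}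

instance (N r M : ℕ) (j : Fin N) : Fintype (QueryIdx N r M j) :=
  inferInstanceAs (Fintype {x : (symMatrix N r (M - 2)).Row × Finset (Fin M) //
    x.2.Nonempty ∧ x.2.card = (symMatrix N r (M - 2)).entry x.1 j})

/-- The queries that involve message `m`. -/
def DesiredIdx (N r M : ℕ) (m : Fin M) : Type :=
  {x : Σ j, QueryIdx N r M j // m ∈ x.2.1.2}

instance (N r M : ℕ) (m : Fin M) : Fintype (DesiredIdx N r M m) :=
  inferInstanceAs (Fintype {x : Σ j, QueryIdx N r M j // m ∈ x.2.1.2})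

/-- Indices of the random vectors that generate the message-`m'` parts of the interference when message
`m` is desired: `r` vectors for every block and every set `U` of `level` many undesired messages
containing `m'`. -/
def NoiseIdx (N r M : ℕ) (m m' : Fin M) : Type :=
  {κ : Block N r (M - 2) × Finset (Fin M) × Fin r //
    m ∉ κ.2.1 ∧ m' ∈ κ.2.1 ∧ κ.2.1.card = κ.1.level}

instance (N r M : ℕ) (m m' : Fin M) : Finite (NoiseIdx N r M m m') :=
  inferInstanceAs (Finite {κ : Block N r (M - 2) × Finset (Fin M) × Fin r //
    m ∉ κ.2.1 ∧ m' ∈ κ.2.1 ∧ κ.2.1.card = κ.1.level})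

instance (N r M : ℕ) (m m' : Fin M) : Fintype (NoiseIdx N r M m m') := Fintype.ofFinite _

/-- The randomness of the user: vectors `s.1.1 x` for the desired message `m` and vectors `s.1.2 m' κ`
for the others, linearly independent for each message. -/
def Seed (F : Type) [Field F] (N r M L : ℕ) (m : Fin M) : Type :=
  {s : (DesiredIdx N r M m → Fin L → F) × (∀ m', NoiseIdx N r M m m' → Fin L → F) //
    LinearIndependent F s.1 ∧ ∀ m', LinearIndependent F (s.2 m')}

instance (F : Type) [Field F] [Fintype F] (N r M L : ℕ) (m : Fin M) :
    Fintype (Seed F N r M L m) :=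
  haveI : Finite (Seed F N r M L m) := inferInstanceAs (Finite
    {s : (DesiredIdx N r M m → Fin L → F) × (∀ m', NoiseIdx N r M m m' → Fin L → F) //
      LinearIndependent F s.1 ∧ ∀ m', LinearIndependent F (s.2 m')})
  Fintype.ofFinite _

/-- The queries obtained from the randomness `s` when message `m` is desired. The query with row `i`
and message set `U` for server `j` is the vector of the desired message (if `m ∈ U`) plus the
interference of the messages in `U \ {m}`. The latter is the symbol for server `j` of the codeword, with
generator `gen`, of the block that contains the cell `(i, j)` and has level `#(U \ {m})` (there is
exactly one such block if `U \ {m}` is nonempty). -/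
def liftedQueries {F : Type} [Field F] {N r : ℕ} (gen : Matrix (Fin N) (Fin r) F) (M L : ℕ)
    (m : Fin M) (s : Seed F N r M L m) (j : Fin N) (x : QueryIdx N r M j) : LinQuery F M L :=
  fun m' =>
    (if h : m' = m ∧ m ∈ x.1.2 then s.1.1 ⟨⟨j, x⟩, h.2⟩ else 0) +
    ∑ κ : NoiseIdx N r M m m',
      if κ.1.2.1 = x.1.2.erase m ∧ κ.1.1.row j = x.1.1 then gen j κ.1.2.2 • s.1.2 m' κ else 0

/-- The scheme obtained by refining and lifting, to `M` messages of length `N ^ (M - 1)`, the one-shot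
scheme of codimension `r` whose noise is generated by `gen`. The randomness is uniform. (For
`1 ≤ r < N` and `2 ≤ M` the space of seeds is nonempty: there are `N ^ (M - 1)` vectors for the desired
message and `r * N ^ (M - 2)` vectors for each of the others. The value in the other case is
immaterial.) -/
def refineLift {F : Type} [Field F] [Fintype F] {N r : ℕ} (gen : Matrix (Fin N) (Fin r) F) (M : ℕ) :
    LinearScheme F N M (N ^ (M - 1)) where
  Idx j := QueryIdx N r M j
  finIdx _ := inferInstance
  law m :=
    if h : Nonempty (Seed F N r M (N ^ (M - 1)) m) then
      (@PMF.uniformOfFintype (Seed F N r M (N ^ (M - 1)) m) _ h).map (liftedQueries gen M _ m)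
    else PMF.pure 0

/-! ### The Sun-Jafar scheme -/

/-- The queries of the Sun-Jafar scheme for replicated data with `T` colluding servers, which retrieves
messages of length `N ^ M`: every server is sent, for every nonempty set `U` of messages,
`T ^ (M - #U) * (N - T) ^ (#U - 1)` queries that are sums of one vector for each message in `U`. -/
abbrev SunJafarQuery (N T M : ℕ) : Type :=
  Σ _ : Fin N, Σ U : {U : Finset (Fin M) // U.Nonempty},
    Fin (T ^ (M - U.1.card) * (N - T) ^ (U.1.card - 1))

end PIR

end

/-! Upper bound. Take the database uniformly random and measure the entropy of the answers given a
set `S` of messages. All answers reveal the desired message `m`, so moving `m` into the conditioning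
costs exactly `L log |F|` (`meanEntropy_eq_add`). By privacy the entropy seen by any `T` servers
does not depend on the desired message, and Shearer's inequality over the `N` cyclic windows of `T`
servers compares these with the entropy of all answers; switching the desired message therefore
costs at most a factor `T / N` (`mul_meanEntropy_le`). Conditioning on the messages one at a time
yields the geometric sum in `T / N` (`le_download`), whose inverse is the stated rate.

Correctness of the lifted scheme. In each block, `T` cells have the smaller value, and for them
there are queries consisting of interference alone. By the MDS property these determine the whole
interference codeword, which is then removed from the other cells. What remains is `N ^ (M - 1)`
independent functionals of the desired message, enough to determine it (`interference_eq_zero`,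
`refineLift_correct`).

Privacy. For any `T` servers and every message, the parts of the queries that involve this message
are linearly independent: by choice if it is desired, by the MDS property otherwise
(`linearIndependent_liftedQueries`). A change of coordinates in each message preserves the law, and
such changes act transitively on independent families. So the law is the uniform one on a single
orbit, which is the same for every desired message (`refineLift_private`).

The counts come from one weighted sum over the symbolic matrix (`sum_symMatrix`) and the binomial
theorem. -/

noncomputable section

namespace PIR

/-! ### Entropy of partitions of a finite set. -/

section Entropy

variable {Ω : Type*} [Fintype Ω]

/-- The number of elements in the class of `x`. -/
def classCard (r : Setoid Ω) (x : Ω) : ℕ := (Finset.univ.filter (fun y => r y x)).card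

/-- The entropy, in nats, of the class of a uniformly random element. -/
def entropy (r : Setoid Ω) : ℝ :=
  (∑ x, (Real.log (Fintype.card Ω) - Real.log (classCard r x))) / Fintype.card Ω

lemma classCard_pos (r : Setoid Ω) (x : Ω) : 0 < classCard r x :=
  Finset.card_pos.2 ⟨x, by simp⟩

lemma classCard_mono {r s : Setoid Ω} (h : r ≤ s) (x : Ω) : classCard r x ≤ classCard s x :=
  Finset.card_le_card (Finset.monotone_filter_right _ fun _ _ hy => h hy)

lemma classCard_congr {r : Setoid Ω} {x y : Ω} (h : r x y) : classCard r x = classCard r y := by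
  unfold classCard
  congr 1
  ext z
  simp only [Finset.mem_filter, Finset.mem_univ, true_and]
  exact ⟨fun hz => r.trans hz h, fun hz => r.trans hz (r.symm h)⟩

lemma entropy_anti {r s : Setoid Ω} (h : r ≤ s) : entropy s ≤ entropy r := by
  unfold entropy
  gcongr with x
  · exact_mod_cast classCard_pos r x
  · exact classCard_mono h x

/-- The points of `p` lie in a single class, and each has weight one over the size of that class. -/
lemma sum_inv_classCard_le_one (r : Setoid Ω) (p : Ω → Prop) [DecidablePred p]
    (hp : ∀ x y, p x → p y → r x y) :
    ∑ x, (if p x then (1 : ℝ) / classCard r x else 0) ≤ 1 := by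
  by_cases h : ∃ x₀, p x₀
  · obtain ⟨x₀, h₀⟩ := h
    have hc : (0 : ℝ) < classCard r x₀ := by exact_mod_cast classCard_pos r x₀
    calc ∑ x, (if p x then (1 : ℝ) / classCard r x else 0)
        ≤ ∑ x, (if r x x₀ then (1 : ℝ) / classCard r x₀ else 0) := by
          refine Finset.sum_le_sum fun x _ => ?_
          by_cases hx : p x
          · rw [if_pos hx, if_pos (hp _ _ hx h₀), classCard_congr (hp _ _ hx h₀)]
          · rw [if_neg hx]
            split_ifs <;> positivity
      _ = 1 := by
          rw [← Finset.sum_filter, Finset.sum_const, nsmul_eq_mul]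
          change (classCard r x₀ : ℝ) * _ = 1
          field_simp
  · push Not at h
    simp [h]

/-- Apply `log y ≤ y - 1` to `|Ω| / (|β| * class size)`. The inverse class sizes sum to at most
`|β|`, since each fibre contributes at most one. -/
lemma entropy_ker_le [Nonempty Ω] {β : Type*} [Fintype β] (f : Ω → β) :
    entropy (Setoid.ker f) ≤ Real.log (Fintype.card β) := by
  have hn : (0 : ℝ) < Fintype.card Ω := by exact_mod_cast Fintype.card_pos
  have : Nonempty β := ⟨f (Classical.arbitrary Ω)⟩
  have hb : (0 : ℝ) < Fintype.card β := by exact_mod_cast Fintype.card_pos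
  unfold entropy
  rw [div_le_iff₀ hn, ← sub_nonpos]
  have h1 : ∑ x, (1 : ℝ) / classCard (Setoid.ker f) x ≤ Fintype.card β := by
    calc ∑ x, (1 : ℝ) / classCard (Setoid.ker f) x
        = ∑ x, ∑ b : β, (if f x = b then (1 : ℝ) / classCard (Setoid.ker f) x else 0) := by simp
      _ = ∑ b : β, ∑ x, (if f x = b then (1 : ℝ) / classCard (Setoid.ker f) x else 0) :=
          Finset.sum_comm
      _ ≤ ∑ _b : β, (1 : ℝ) := Finset.sum_le_sum fun b _ =>
          sum_inv_classCard_le_one _ _ fun x y hx hy => by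
            rw [Setoid.ker_def, hx, hy]
      _ = Fintype.card β := by simp
  calc ∑ x, (Real.log (Fintype.card Ω) - Real.log (classCard (Setoid.ker f) x))
        - Real.log (Fintype.card β) * Fintype.card Ω
      = ∑ x, (Real.log (Fintype.card Ω) - Real.log (classCard (Setoid.ker f) x)
        - Real.log (Fintype.card β)) := by
        rw [Finset.sum_sub_distrib]; simp [mul_comm]
    _ ≤ ∑ x, ((Fintype.card Ω / Fintype.card β : ℝ) * (1 / classCard (Setoid.ker f) x) - 1) := by
        refine Finset.sum_le_sum fun x _ => ?_
        have hc : (0 : ℝ) < classCard (Setoid.ker f) x := by exact_mod_cast classCard_pos _ x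
        rw [← Real.log_div hn.ne' hc.ne', ← Real.log_div (by positivity) hb.ne']
        refine (Real.log_le_sub_one_of_pos (by positivity)).trans (le_of_eq ?_)
        field_simp
    _ ≤ 0 := by
        rw [Finset.sum_sub_distrib, ← Finset.mul_sum]
        have : (Fintype.card Ω / Fintype.card β : ℝ) * ∑ x, (1 : ℝ) / classCard (Setoid.ker f) x
            ≤ (Fintype.card Ω / Fintype.card β : ℝ) * Fintype.card β := by gcongr
        rw [div_mul_cancel₀ _ hb.ne'] at this
        simp only [Finset.sum_const, Finset.card_univ, nsmul_eq_mul, mul_one]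
        linarith

/-- The product in the numerator counts pairs `(y, z)` with `y` in the `r`-class and `z` in the
`s`-class of `x`. For a fixed pair the admissible `x` lie in one class of `r ⊓ s` and contribute at
most one in total; `x`, `y`, `z` share a `t`-class, whose size cancels the sum over `z`. -/
lemma sum_classCard_ratio_le {r s t : Setoid Ω} (hr : r ≤ t) (hs : s ≤ t) :
    ∑ x, ((classCard r x : ℝ) * classCard s x) / (classCard (r ⊓ s) x * classCard t x)
      ≤ Fintype.card Ω := by
  have hcard (u : Setoid Ω) (x : Ω) : (classCard u x : ℝ) = ∑ y, if u y x then (1 : ℝ) else 0 := by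
    simp [classCard]
  calc ∑ x, ((classCard r x : ℝ) * classCard s x) / (classCard (r ⊓ s) x * classCard t x)
      = ∑ x, ∑ y, ∑ z, (if r y x ∧ s z x then
          (1 : ℝ) / (classCard (r ⊓ s) x * classCard t x) else 0) := by
        refine Finset.sum_congr rfl fun x _ => ?_
        rw [hcard r, hcard s, Finset.sum_mul_sum, Finset.sum_div]
        refine Finset.sum_congr rfl fun y _ => ?_
        rw [Finset.sum_div]
        refine Finset.sum_congr rfl fun z _ => ?_
        by_cases h1 : r y x <;> by_cases h2 : s z x <;> simp [h1, h2]
    _ = ∑ y, ∑ z, ∑ x, (if r y x ∧ s z x then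
          (1 : ℝ) / (classCard (r ⊓ s) x * classCard t x) else 0) := by
        rw [Finset.sum_comm]
        exact Finset.sum_congr rfl fun y _ => Finset.sum_comm
    _ ≤ ∑ y, ∑ z, (if t z y then (1 : ℝ) / classCard t y else 0) := by
        refine Finset.sum_le_sum fun y _ => Finset.sum_le_sum fun z _ => ?_
        have key : ∀ x, (if r y x ∧ s z x then
            (1 : ℝ) / (classCard (r ⊓ s) x * classCard t x) else 0)
            = (if t z y then (1 : ℝ) / classCard t y else 0) *
              (if r y x ∧ s z x then (1 : ℝ) / classCard (r ⊓ s) x else 0) := by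
          intro x
          by_cases h : r y x ∧ s z x
          · have h1 : t y x := hr h.1
            have h2 : t z y := t.trans (hs h.2) (t.symm h1)
            rw [if_pos h, if_pos h2, if_pos h, classCard_congr h1, one_div_mul_one_div,
              mul_comm]
          · simp [h]
        simp_rw [key]
        rw [← Finset.mul_sum]
        refine mul_le_of_le_one_right (by split_ifs <;> positivity) ?_
        refine sum_inv_classCard_le_one (r ⊓ s) (fun x => r y x ∧ s z x) fun a b ha hb => ?_
        exact ⟨r.trans (r.symm ha.1) hb.1, s.trans (s.symm ha.2) hb.2⟩
    _ = ∑ _y : Ω, (1 : ℝ) := by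
        refine Finset.sum_congr rfl fun y _ => ?_
        have hc : (classCard t y : ℝ) ≠ 0 := by exact_mod_cast (classCard_pos t y).ne'
        rw [← Finset.sum_filter (fun z => t z y), Finset.sum_const, nsmul_eq_mul]
        change (classCard t y : ℝ) * _ = 1
        field_simp
    _ = Fintype.card Ω := by simp

/-- This is the nonnegativity of conditional mutual information given `t`. Any common coarsening `t`
is allowed, not only the join, because the answers of the servers in `J ∩ K` need not generate the
join of those of `J` and `K`. -/
lemma entropy_submodular {r s t : Setoid Ω} (hr : r ≤ t) (hs : s ≤ t) :
    entropy (r ⊓ s) + entropy t ≤ entropy r + entropy s := by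
  unfold entropy
  rw [← add_div, ← add_div, ← Finset.sum_add_distrib, ← Finset.sum_add_distrib]
  refine div_le_div_of_nonneg_right ?_ (Nat.cast_nonneg _)
  rw [← sub_nonpos, ← Finset.sum_sub_distrib]
  calc _ ≤ ∑ x, (((classCard r x : ℝ) * classCard s x) / (classCard (r ⊓ s) x * classCard t x) - 1) := by
        refine Finset.sum_le_sum fun x _ => ?_
        have h1 : (0 : ℝ) < classCard r x := by exact_mod_cast classCard_pos _ x
        have h2 : (0 : ℝ) < classCard s x := by exact_mod_cast classCard_pos _ x
        have h3 : (0 : ℝ) < classCard (r ⊓ s) x := by exact_mod_cast classCard_pos _ x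
        have h4 : (0 : ℝ) < classCard t x := by exact_mod_cast classCard_pos _ x
        refine le_trans (le_of_eq ?_) (Real.log_le_sub_one_of_pos (by positivity))
        rw [Real.log_div (by positivity) (by positivity), Real.log_mul h1.ne' h2.ne',
          Real.log_mul h3.ne' h4.ne']
        ring
    _ ≤ 0 := by
        rw [Finset.sum_sub_distrib]
        have := sum_classCard_ratio_le hr hs
        simp only [Finset.sum_const, Finset.card_univ, nsmul_eq_mul, mul_one]
        linarith

lemma entropy_top : entropy (⊤ : Setoid Ω) = 0 := by
  have h (x : Ω) : classCard (⊤ : Setoid Ω) x = Fintype.card Ω := by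
    simp [classCard]
  simp [entropy, h]

end Entropy

/-! ### Cyclic shifts of the columns and Shearer's inequality. -/

section Cyclic

variable {N : ℕ}

lemma cyc_right_injective (t : ℕ) : Function.Injective (cyc t : Fin N → Fin N) := by
  intro i j h
  have h1 : (i + t) % N = (j + t) % N := congrArg Fin.val h
  have h2 : (i : ℕ) ≡ j [MOD N] := Nat.ModEq.add_right_cancel' t h1
  exact Fin.ext (by rwa [Nat.ModEq, Nat.mod_eq_of_lt i.2, Nat.mod_eq_of_lt j.2] at h2)

lemma cyc_bijective (t : ℕ) : Function.Bijective (cyc t : Fin N → Fin N) :=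
  Finite.injective_iff_bijective.1 (cyc_right_injective t)

lemma cyc_left_injective {r : ℕ} (hr : r ≤ N) (j : Fin N) :
    Function.Injective (fun t : Fin r => cyc (t : ℕ) j) := by
  intro s t h
  have h1 : ((j : ℕ) + s) % N = (j + t) % N := congrArg Fin.val h
  have h2 : (s : ℕ) ≡ t [MOD N] := Nat.ModEq.add_left_cancel' (j : ℕ) h1
  exact Fin.ext (by
    rwa [Nat.ModEq, Nat.mod_eq_of_lt (s.2.trans_le hr), Nat.mod_eq_of_lt (t.2.trans_le hr)] at h2)

/-- `T` cyclically consecutive elements, starting from `i`. -/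
def window (T : ℕ) (i : Fin N) : Finset (Fin N) :=
  Finset.univ.image fun t : Fin T => cyc (t : ℕ) i

lemma card_window {T : ℕ} (hT : T ≤ N) (i : Fin N) : (window T i).card = T := by
  rw [window, Finset.card_image_of_injective _ (cyc_left_injective hT i)]
  simp

/-- Diminishing returns: adding `j` to all smaller indices gains no more than adding it to the
smaller elements of `J`, and the latter gains telescope to `h J`. -/
lemma sum_marginal_le {h : Finset (Fin N) → ℝ} (h0 : h ∅ = 0)
    (hsub : ∀ J K, h (J ∪ K) + h (J ∩ K) ≤ h J + h K) (J : Finset (Fin N)) :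
    ∑ j ∈ J, (h (Finset.univ.filter fun i => (i : ℕ) < j + 1)
      - h (Finset.univ.filter fun i => (i : ℕ) < j)) ≤ h J := by
  induction J using Finset.induction_on_max with
  | empty => simp [h0]
  | insert a J hJ ih =>
    have ha : a ∉ J := fun h => lt_irrefl _ (hJ a h)
    rw [Finset.sum_insert ha]
    have := hsub (insert a J) (Finset.univ.filter fun i => (i : ℕ) < a)
    have e1 : insert a J ∪ (Finset.univ.filter fun i : Fin N => (i : ℕ) < a)
        = Finset.univ.filter fun i : Fin N => (i : ℕ) < a + 1 := by
      ext i
      simp only [Finset.mem_union, Finset.mem_insert, Finset.mem_filter, Finset.mem_univ, true_and]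
      constructor
      · rintro ((rfl | hi) | hi)
        · omega
        · have := hJ i hi
          rw [Fin.lt_def] at this
          omega
        · omega
      · intro hi
        by_cases h' : (i : ℕ) < a
        · exact Or.inr h'
        · exact Or.inl (Or.inl (Fin.ext (by omega)))
    have e2 : insert a J ∩ (Finset.univ.filter fun i : Fin N => (i : ℕ) < a) = J := by
      ext i
      simp only [Finset.mem_inter, Finset.mem_insert, Finset.mem_filter, Finset.mem_univ, true_and]
      constructor
      · rintro ⟨rfl | hi, h'⟩
        · exact absurd h' (lt_irrefl _)
        · exact hi
      · exact fun hi => ⟨Or.inr hi, Fin.lt_def.1 (hJ i hi)⟩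
    rw [e1, e2] at this
    linarith

/-- Shearer's inequality for the cyclic windows. -/
lemma mul_univ_le_sum_window {T : ℕ} (hT : T ≤ N) {h : Finset (Fin N) → ℝ} (h0 : h ∅ = 0)
    (hsub : ∀ J K, h (J ∪ K) + h (J ∩ K) ≤ h J + h K) :
    T * h Finset.univ ≤ ∑ i, h (window T i) := by
  set H : ℕ → ℝ := fun n => h (Finset.univ.filter fun i : Fin N => (i : ℕ) < n) with hH
  have htel : ∑ j : Fin N, (H (j + 1) - H j) = h Finset.univ := by
    rw [Fin.sum_univ_eq_sum_range (fun n => H (n + 1) - H n) N, Finset.sum_range_sub]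
    have e1 : H 0 = 0 := by simp [hH, h0]
    have e2 : H N = h Finset.univ := by simp [hH]
    rw [e1, e2, sub_zero]
  -- Each shift permutes the indices, so the `T` shifts together count every marginal gain exactly
  -- `T` times; regrouped by starting point, they fill the windows.
  calc T * h Finset.univ = ∑ t : Fin T, ∑ i : Fin N, (H (cyc t i + 1) - H (cyc t i)) := by
        rw [← htel]
        have (t : Fin T) : ∑ i : Fin N, (H (cyc t i + 1) - H (cyc t i))
            = ∑ j : Fin N, (H (j + 1) - H j) :=
          Function.Bijective.sum_comp (cyc_bijective (N := N) t) fun j : Fin N => H (j + 1) - H j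
        simp only [this, Finset.sum_const, Finset.card_univ, Fintype.card_fin, nsmul_eq_mul]
    _ = ∑ i, ∑ j ∈ window T i, (H (j + 1) - H j) := by
        rw [Finset.sum_comm]
        refine Finset.sum_congr rfl fun i _ => ?_
        rw [window, Finset.sum_image ((cyc_left_injective hT i).injOn)]
    _ ≤ ∑ i, h (window T i) := Finset.sum_le_sum fun i _ => sum_marginal_le h0 hsub _

end Cyclic

/-! ### Expectations that depend only on a marginal law. -/

lemma tsum_map_mul {α β : Type*} (p : PMF α) (g : α → β) (f : β → ℝ≥0∞) :
    ∑' b, p.map g b * f b = ∑' a, p a * f (g a) := by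
  simp_rw [PMF.map_apply, ← ENNReal.tsum_mul_right]
  rw [ENNReal.tsum_comm]
  refine tsum_congr fun a => ?_
  rw [tsum_eq_single (g a)]
  · simp
  · intro b hb
    simp [hb]

lemma tsum_mul_eq_of_map_eq {α β : Type*} {p p' : PMF α} {g : α → β} (h : p.map g = p'.map g)
    {f : α → ℝ≥0∞} (hf : f.FactorsThrough g) : ∑' a, p a * f a = ∑' a, p' a * f a := by
  have key (p : PMF α) : ∑' a, p a * f a = ∑' b, p.map g b * (Function.extend g f 0) b := by
    rw [tsum_map_mul]
    exact tsum_congr fun a => by rw [hf.extend_apply]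
  rw [key, key, h]

lemma finset_inf_apply {α ι : Type*} (J : Finset ι) (r : ι → Setoid α) (x y : α) :
    (J.inf r) x y ↔ ∀ j ∈ J, r j x y := by
  induction J using Finset.induction_on with
  | empty => exact iff_of_true trivial (by simp)
  | insert a J _ ih =>
    rw [Finset.inf_insert, Setoid.inf_iff_and, ih]
    simp

/-! ### Entropy of a set of messages. -/

section Database

variable {F : Type} [Field F] [Fintype F] {M L : ℕ}

/-- Databases that agree on the messages in `S`. -/
def agreeOn (F : Type) [Field F] [Fintype F] (M L : ℕ) (S : Finset (Fin M)) :
    Setoid (Database F M L) :=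
  S.inf fun m => Setoid.ker fun D => D m

lemma agreeOn_apply {S : Finset (Fin M)} {D D' : Database F M L} :
    agreeOn F M L S D D' ↔ ∀ m ∈ S, D m = D' m := finset_inf_apply _ _ _ _

lemma classCard_agreeOn (S : Finset (Fin M)) (D : Database F M L) :
    classCard (agreeOn F M L S) D = (Fintype.card F ^ L) ^ (M - S.card) := by
  have h : (Finset.univ.filter fun D' => agreeOn F M L S D' D)
      = Fintype.piFinset fun m => if m ∈ S then {D m} else (Finset.univ : Finset (Fin L → F)) := by
    ext D'
    simp only [Finset.mem_filter, Finset.mem_univ, true_and, agreeOn_apply, Fintype.mem_piFinset]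
    refine forall_congr' fun m => ?_
    by_cases hm : m ∈ S <;> simp [hm]
  unfold classCard
  rw [h, Fintype.card_piFinset]
  have h2 (m : Fin M) : (if m ∈ S then {D m} else (Finset.univ : Finset (Fin L → F))).card
      = if m ∈ S then 1 else Fintype.card F ^ L := by
    split_ifs <;> simp
  simp_rw [h2]
  rw [Finset.prod_ite]
  simp only [Finset.prod_const_one, one_mul, Finset.prod_const]
  congr 1
  rw [Finset.filter_not, Finset.filter_mem_eq_inter, Finset.univ_inter, ← Finset.compl_eq_univ_sdiff,
    Finset.card_compl, Fintype.card_fin]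

lemma entropy_agreeOn_insert {S : Finset (Fin M)} {m : Fin M} (hm : m ∉ S) :
    entropy (agreeOn F M L (insert m S))
      = entropy (agreeOn F M L S) + L * Real.log (Fintype.card F) := by
  have hlt : S.card < M := by
    have := Finset.card_le_univ (insert m S)
    rw [Finset.card_insert_of_notMem hm, Fintype.card_fin] at this
    exact this
  have hn : (Fintype.card (Database F M L) : ℝ) ≠ 0 := by
    exact_mod_cast Fintype.card_ne_zero
  obtain ⟨d, hd⟩ : ∃ d, M - S.card = d + 1 := ⟨M - S.card - 1, by omega⟩
  have hd' : M - (S.card + 1) = d := by omega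
  unfold entropy
  simp_rw [classCard_agreeOn, Finset.card_insert_of_notMem hm, hd, hd']
  simp only [Finset.sum_const, Finset.card_univ, nsmul_eq_mul]
  rw [mul_div_cancel_left₀ _ hn, mul_div_cancel_left₀ _ hn]
  push_cast
  simp only [Real.log_pow]
  push_cast
  ring

end Database

/-! ### The upper bound on the rate of an arbitrary scheme. -/

namespace Scheme

variable {F : Type} [Field F] [Fintype F] {N M L : ℕ}

/-- The partition of the databases by the answers of the servers in `J`. -/
def answerSetoid (P : Scheme F N M L) (q : ∀ j, P.Query j) (J : Finset (Fin N)) :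
    Setoid (Database F M L) :=
  J.inf fun j => Setoid.ker (P.answer j (q j))

/-- The entropy of the answers of the servers in `J` given the messages in `S`. -/
def condEntropy (P : Scheme F N M L) (q : ∀ j, P.Query j) (S : Finset (Fin M))
    (J : Finset (Fin N)) : ℝ :=
  entropy (P.answerSetoid q J ⊓ agreeOn F M L S) - entropy (agreeOn F M L S)

/-- The expected entropy of all answers given the messages in `S`, if `m` is desired. -/
def meanEntropy (P : Scheme F N M L) (m : Fin M) (S : Finset (Fin M)) (J : Finset (Fin N)) : ℝ≥0∞ :=
  ∑' q, P.law m q * ENNReal.ofReal (P.condEntropy q S J)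

variable {P : Scheme F N M L}

lemma condEntropy_empty (q : ∀ j, P.Query j) (S : Finset (Fin M)) : P.condEntropy q S ∅ = 0 := by
  simp [condEntropy, answerSetoid]

lemma condEntropy_mono (q : ∀ j, P.Query j) (S : Finset (Fin M)) {J K : Finset (Fin N)}
    (h : J ⊆ K) : P.condEntropy q S J ≤ P.condEntropy q S K :=
  sub_le_sub_right (entropy_anti (inf_le_inf_right _ (Finset.inf_mono h))) _

lemma condEntropy_nonneg (q : ∀ j, P.Query j) (S : Finset (Fin M)) (J : Finset (Fin N)) :
    0 ≤ P.condEntropy q S J :=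
  sub_nonneg.2 (entropy_anti inf_le_right)

lemma condEntropy_submodular (q : ∀ j, P.Query j) (S : Finset (Fin M)) (J K : Finset (Fin N)) :
    P.condEntropy q S (J ∪ K) + P.condEntropy q S (J ∩ K)
      ≤ P.condEntropy q S J + P.condEntropy q S K := by
  have h := entropy_submodular (r := P.answerSetoid q J ⊓ agreeOn F M L S)
    (s := P.answerSetoid q K ⊓ agreeOn F M L S) (t := P.answerSetoid q (J ∩ K) ⊓ agreeOn F M L S)
    (inf_le_inf_right _ (Finset.inf_mono Finset.inter_subset_left))
    (inf_le_inf_right _ (Finset.inf_mono Finset.inter_subset_right))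
  rw [← inf_inf_distrib_right] at h
  have hu : P.answerSetoid q (J ∪ K) = P.answerSetoid q J ⊓ P.answerSetoid q K := Finset.inf_union
  unfold condEntropy
  rw [hu]
  linarith

/-- For fixed queries there are only `|F| ^ downloadOf q` possible tuples of answers. -/
lemma condEntropy_le_download (q : ∀ j, P.Query j) :
    P.condEntropy q ∅ Finset.univ ≤ P.downloadOf q * Real.log (Fintype.card F) := by
  let (j : Fin N) : Fintype (P.Pos j (q j)) := P.finPos j (q j)
  have h : P.answerSetoid q Finset.univ
      = Setoid.ker (fun D => fun j => P.answer j (q j) D) := by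
    ext D D'
    rw [answerSetoid, finset_inf_apply, Setoid.ker_def, funext_iff]
    simp [Setoid.ker_def]
  have h2 := entropy_ker_le (fun D : Database F M L => fun j => P.answer j (q j) D)
  unfold condEntropy
  rw [h]
  simp only [agreeOn, Finset.inf_empty, inf_top_eq, entropy_top, sub_zero]
  refine h2.trans (le_of_eq ?_)
  rw [Fintype.card_pi]
  simp only [Fintype.card_fun]
  rw [Finset.prod_pow_eq_pow_sum]
  push_cast
  rw [Real.log_pow]
  rfl

/-- Since the answers determine message `m`, adding it to `S` does not refine the joint partition;
only the subtracted entropy of the messages changes. -/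
lemma condEntropy_eq_add {m : Fin M} {S : Finset (Fin M)} (hm : m ∉ S) {q : ∀ j, P.Query j}
    (hq : ∀ D D' : Database F M L, (∀ j, P.answer j (q j) D = P.answer j (q j) D') → D m = D' m) :
    P.condEntropy q S Finset.univ
      = L * Real.log (Fintype.card F) + P.condEntropy q (insert m S) Finset.univ := by
  have h : P.answerSetoid q Finset.univ ⊓ agreeOn F M L S
      = P.answerSetoid q Finset.univ ⊓ agreeOn F M L (insert m S) := by
    rw [agreeOn, agreeOn, Finset.inf_insert, ← inf_assoc]
    congr 1
    symm
    rw [inf_eq_left]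
    intro D D' hD
    rw [answerSetoid, finset_inf_apply] at hD
    exact hq D D' fun j => hD j (Finset.mem_univ j)
  unfold condEntropy
  rw [entropy_agreeOn_insert hm, h]
  ring

/-- Correctness is assumed on the support only, so query tuples of mass zero are treated apart.
Expectations in `ℝ≥0∞` need no summability, although the query types may be infinite. -/
lemma meanEntropy_eq_add (hP : P.Correct) {m : Fin M} {S : Finset (Fin M)} (hm : m ∉ S) :
    P.meanEntropy m S Finset.univ = ENNReal.ofReal (L * Real.log (Fintype.card F))
      + P.meanEntropy m (insert m S) Finset.univ := by
  have h (q : ∀ j, P.Query j) : P.law m q * ENNReal.ofReal (P.condEntropy q S Finset.univ)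
      = P.law m q * ENNReal.ofReal (L * Real.log (Fintype.card F))
        + P.law m q * ENNReal.ofReal (P.condEntropy q (insert m S) Finset.univ) := by
    by_cases hq : P.law m q = 0
    · simp [hq]
    · rw [condEntropy_eq_add hm (hP m q ((PMF.mem_support_iff _ _).2 hq)),
        ENNReal.ofReal_add (by positivity) (condEntropy_nonneg _ _ _), mul_add]
  unfold meanEntropy
  simp_rw [h]
  rw [ENNReal.tsum_add, ENNReal.tsum_mul_right, PMF.tsum_coe, one_mul]

lemma meanEntropy_congr {T : ℕ} (hP : P.Private T) (m m' : Fin M) (S : Finset (Fin M))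
    {J : Finset (Fin N)} (hJ : J.card = T) : P.meanEntropy m S J = P.meanEntropy m' S J := by
  refine tsum_mul_eq_of_map_eq (hP J hJ m m') ?_
  intro q q' hq
  have : P.answerSetoid q J = P.answerSetoid q' J :=
    Finset.inf_congr rfl fun j hj => by rw [show q j = q' j from congrFun hq ⟨j, hj⟩]
  simp only [condEntropy, this]

/-- Shearer's inequality passes to windows of `T` servers, privacy exchanges `m'` for `m` on each
window, and monotonicity returns to all servers. -/
lemma mul_meanEntropy_le {T : ℕ} (hTN : T ≤ N) (hP : P.Private T) (m m' : Fin M)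
    (S : Finset (Fin M)) :
    T * P.meanEntropy m' S Finset.univ ≤ N * P.meanEntropy m S Finset.univ := by
  calc T * P.meanEntropy m' S Finset.univ
      ≤ ∑ i, P.meanEntropy m' S (window T i) := by
        unfold meanEntropy
        rw [← ENNReal.tsum_mul_left, ← tsum_fintype (L := .unconditional _), ENNReal.tsum_comm]
        refine ENNReal.tsum_le_tsum fun q => ?_
        rw [ENNReal.tsum_mul_left, mul_left_comm]
        gcongr
        rw [tsum_fintype, ← ENNReal.ofReal_sum_of_nonneg fun i _ => condEntropy_nonneg _ _ _,
          ← ENNReal.ofReal_natCast, ← ENNReal.ofReal_mul (Nat.cast_nonneg _)]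
        exact ENNReal.ofReal_le_ofReal (mul_univ_le_sum_window hTN (condEntropy_empty q S)
          (condEntropy_submodular q S))
    _ = ∑ i, P.meanEntropy m S (window T i) :=
        Finset.sum_congr rfl fun i _ => meanEntropy_congr hP _ _ _ (card_window hTN i)
    _ ≤ ∑ _i : Fin N, P.meanEntropy m S Finset.univ := by
        refine Finset.sum_le_sum fun i _ => ENNReal.tsum_le_tsum fun q => ?_
        gcongr
        exact condEntropy_mono q S (Finset.subset_univ _)
    _ = N * P.meanEntropy m S Finset.univ := by simp

/-- Induction on the number `k` of messages outside `S`: message `m` supplies the term `1` of the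
geometric sum, and the switch to another message outside `S` multiplies the remaining sum by `T /
N`. -/
lemma le_meanEntropy {T : ℕ} (hTN : T < N) (hP : P.IsPIR T) (k : ℕ) :
    ∀ (m : Fin M) (S : Finset (Fin M)), m ∉ S → S.card + k = M →
      ENNReal.ofReal (L * Real.log (Fintype.card F) * ∑ i ∈ Finset.range k, ((T : ℝ) / N) ^ i)
        ≤ P.meanEntropy m S Finset.univ := by
  have hN : (0 : ℝ) < N := by exact_mod_cast (Nat.zero_le T).trans_lt hTN
  induction k with
  | zero => intros; simp
  | succ k ih =>
    intro m S hm hS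
    rw [meanEntropy_eq_add hP.1 hm, geom_sum_succ, mul_add, mul_one, add_comm,
      ENNReal.ofReal_add (by positivity) (by positivity)]
    gcongr
    -- After the last message there is none left to switch to, but the remaining sum is empty.
    rcases Nat.eq_zero_or_pos k with rfl | hk
    · simp
    · have hS' : (insert m S).card + k = M := by
        rw [Finset.card_insert_of_notMem hm]
        omega
      obtain ⟨m', hm'⟩ : ∃ m', m' ∉ insert m S := by
        by_contra! h
        have := Finset.card_univ (α := Fin M)
        rw [← Finset.eq_univ_iff_forall.2 h, Fintype.card_fin] at this
        omega
      have h1 := ih m' _ hm' hS'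
      have h2 := mul_meanEntropy_le hTN.le hP.2 m m' (insert m S)
      set B : ℝ := ∑ i ∈ Finset.range k, ((T : ℝ) / N) ^ i
      have h3 : (T : ℝ≥0∞) * ENNReal.ofReal (L * Real.log (Fintype.card F) * B)
          ≤ N * P.meanEntropy m (insert m S) Finset.univ := le_trans (by gcongr) h2
      have h4 : ENNReal.ofReal (L * Real.log (Fintype.card F) * (T / N * B))
          = (T : ℝ≥0∞) * ENNReal.ofReal (L * Real.log (Fintype.card F) * B) / N := by
        rw [← ENNReal.ofReal_natCast T, ← ENNReal.ofReal_natCast N,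
          ← ENNReal.ofReal_mul (Nat.cast_nonneg _), ← ENNReal.ofReal_div_of_pos hN]
        congr 1
        ring
      rw [h4]
      exact ENNReal.div_le_of_le_mul' h3

lemma le_download {T : ℕ} (hTN : T < N) (hM : 1 ≤ M) (hP : P.IsPIR T) :
    ENNReal.ofReal (L * ∑ i ∈ Finset.range M, ((T : ℝ) / N) ^ i) ≤ P.download := by
  have hlog : 0 < Real.log (Fintype.card F) :=
    Real.log_pos (by exact_mod_cast Fintype.one_lt_card)
  have h1 := le_meanEntropy hTN hP M ⟨0, hM⟩ ∅ (by simp) (by simp)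
  have h2 : P.meanEntropy ⟨0, hM⟩ ∅ Finset.univ
      ≤ P.download * ENNReal.ofReal (Real.log (Fintype.card F)) := by
    refine le_trans ?_ (mul_le_mul_left (le_iSup _ (⟨0, hM⟩ : Fin M)) _)
    rw [← ENNReal.tsum_mul_right]
    refine ENNReal.tsum_le_tsum fun q => ?_
    rw [mul_assoc]
    gcongr
    rw [← ENNReal.ofReal_natCast, ← ENNReal.ofReal_mul (Nat.cast_nonneg _)]
    exact ENNReal.ofReal_le_ofReal (condEntropy_le_download q)
  have h3 := h1.trans h2
  rw [mul_right_comm, ENNReal.ofReal_mul (by positivity)] at h3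
  exact (ENNReal.mul_le_mul_iff_left (by simpa using hlog) ENNReal.ofReal_ne_top).1 h3

lemma geom_sum_ratio_mul {T : ℕ} (hTN : T < N) (hM : 1 ≤ M) :
    (∑ i ∈ Finset.range M, ((T : ℝ) / N) ^ i) *
      ((((N : ℝ) - T) * (N : ℝ) ^ (M - 1)) / ((N : ℝ) ^ M - (T : ℝ) ^ M)) = 1 := by
  have hN : (0 : ℝ) < N := by exact_mod_cast (Nat.zero_le T).trans_lt hTN
  have hlt : (T : ℝ) < N := by exact_mod_cast hTN
  have hpow : (T : ℝ) ^ M < (N : ℝ) ^ M := pow_lt_pow_left₀ hlt (Nat.cast_nonneg _) (by omega)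
  have h1 : (T : ℝ) / N ≠ 1 := by
    rw [Ne, div_eq_one_iff_eq hN.ne']
    exact hlt.ne
  obtain ⟨k, rfl⟩ : ∃ k, M = k + 1 := ⟨M - 1, by omega⟩
  have h2 : (N : ℝ) ^ (k + 1) - (T : ℝ) ^ (k + 1) ≠ 0 := (sub_pos.2 hpow).ne'
  have h3 : (T : ℝ) - N ≠ 0 := (sub_neg.2 hlt).ne
  rw [geom_sum_eq h1, div_pow, Nat.add_sub_cancel]
  have h4 : (T : ℝ) / N - 1 = (T - N) / N := by field_simp
  rw [h4]
  field_simp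
  ring

lemma rate_le {T : ℕ} (hTN : T < N) (hM : 1 ≤ M) (hL : 1 ≤ L) (hP : P.IsPIR T) :
    P.rate ≤ (((N : ℝ) - T) * (N : ℝ) ^ (M - 1)) / ((N : ℝ) ^ M - (T : ℝ) ^ M) := by
  have hN : (0 : ℝ) < N := by exact_mod_cast (Nat.zero_le T).trans_lt hTN
  have hL' : (0 : ℝ) < L := by exact_mod_cast hL
  have hG := geom_sum_ratio_mul hTN hM
  set G := ∑ i ∈ Finset.range M, ((T : ℝ) / N) ^ i with hGdef
  have hG0 : 0 < G := by
    refine Finset.sum_pos' (fun i _ => by positivity) ⟨0, Finset.mem_range.2 hM, by simp⟩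
  rw [mul_comm, ← eq_div_iff hG0.ne'] at hG
  rw [hG]
  have h1 : (L : ℝ≥0∞) / P.download ≤ ENNReal.ofReal (1 / G) := by
    have h2 : ENNReal.ofReal (1 / G) = L / ENNReal.ofReal (L * G) := by
      rw [← ENNReal.ofReal_natCast, ← ENNReal.ofReal_div_of_pos (by positivity)]
      congr 1
      field_simp
    rw [h2]
    gcongr
    exact le_download hTN hM hP
  calc P.rate ≤ (ENNReal.ofReal (1 / G)).toReal := ENNReal.toReal_mono ENNReal.ofReal_ne_top h1
    _ = 1 / G := ENNReal.toReal_ofReal (by positivity)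

end Scheme

/-! ### Each cell lies in a unique block of each admissible level. -/

variable {N r : ℕ}

lemma symMatrix_entry_le : ∀ (k : ℕ) (i : (symMatrix N r k).Row) (j : Fin N),
    (symMatrix N r k).entry i j ≤ k + 2
  | 0, _, j => by
    change (if (j : ℕ) < r then 1 else 2) ≤ 2
    split_ifs <;> omega
  | k + 1, Sum.inl (t, i), j => (symMatrix_entry_le k i (cyc t j)).trans (by omega)
  | k + 1, Sum.inr b, j => by
    change (if ∃ t : Fin r, cyc t j = b.1.2 then 0 else k + 2 + 1) ≤ _
    split_ifs <;> omega

namespace Block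

lemma level_le : ∀ {k : ℕ} (B : Block N r k), B.level ≤ k + 1
  | 0, _ => le_rfl
  | _ + 1, Sum.inl (_, g) => (level_le g).trans (by omega)
  | k + 1, Sum.inr _ => show k + 2 ≤ k + 1 + 1 by omega

lemma row_inr_of_exists {k : ℕ} (b : (symMatrix N r k).Cell (k + 2)) {j : Fin N}
    (h : ∃ t : Fin r, cyc t j = b.1.2) :
    Block.row (k := k + 1) (Sum.inr b) j = Sum.inl (h.choose, b.1.1) := dif_pos h

lemma row_inr_of_not_exists {k : ℕ} (b : (symMatrix N r k).Cell (k + 2)) {j : Fin N}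
    (h : ¬ ∃ t : Fin r, cyc t j = b.1.2) :
    Block.row (k := k + 1) (Sum.inr b) j = Sum.inr b := dif_neg h

lemma entry_row_inr {k : ℕ} (b : (symMatrix N r k).Cell (k + 2)) (j : Fin N) :
    (symMatrix N r (k + 1)).entry (Block.row (k := k + 1) (Sum.inr b) j) j
      = if ∃ t : Fin r, cyc t j = b.1.2 then k + 2 else k + 3 := by
  by_cases h : ∃ t : Fin r, cyc t j = b.1.2
  · rw [row_inr_of_exists b h, if_pos h]
    change (symMatrix N r k).entry b.1.1 (cyc h.choose j) = k + 2
    rw [h.choose_spec, b.2]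
  · rw [row_inr_of_not_exists b h, if_neg h]
    exact if_neg h

lemma entry_row : ∀ {k : ℕ} (B : Block N r k) (j : Fin N),
    (symMatrix N r k).entry (B.row j) j = B.level
      ∨ (symMatrix N r k).entry (B.row j) j = B.level + 1
  | 0, _, j => by
    change (if (j : ℕ) < r then 1 else 2) = 1 ∨ (if (j : ℕ) < r then 1 else 2) = 2
    split_ifs <;> simp
  | _ + 1, Sum.inl (t, g), j => entry_row g (cyc t j)
  | k + 1, Sum.inr b, j => by
    rw [entry_row_inr]
    change _ = k + 2 ∨ _ = k + 3
    split_ifs <;> simp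

/-- The level separates inherited blocks (at most `k + 1`) from new ones (`k + 2`). A new block is
recovered from any of its cells: a copy of `b` in a known column and shift reveals `b`, and a
nonzero cell of the added row carries `b` in its row index. -/
lemma eq_of_row_eq : ∀ {k : ℕ} {B B' : Block N r k} {j : Fin N},
    B.level = B'.level → B.row j = B'.row j → B = B'
  | 0, _, _, _, _, _ => rfl
  | k + 1, Sum.inl (t, g), Sum.inl (t', g'), j, hl, hr => by
    have h := Prod.ext_iff.1 (Sum.inl_injective hr)
    obtain rfl : t = t' := h.1
    rw [eq_of_row_eq (k := k) hl h.2]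
  | k + 1, Sum.inl (t, g), Sum.inr b, j, hl, hr => by
    have h1 : level g = k + 2 := hl
    have h2 := level_le g
    omega
  | k + 1, Sum.inr b, Sum.inl (t, g), j, hl, hr => by
    have h1 : k + 2 = level g := hl
    have h2 := level_le g
    omega
  | k + 1, Sum.inr b, Sum.inr b', j, hl, hr => by
    by_cases h : ∃ t : Fin r, cyc t j = b.1.2 <;> by_cases h' : ∃ t : Fin r, cyc t j = b'.1.2
    · rw [row_inr_of_exists b h, row_inr_of_exists b' h'] at hr
      have h2 := Prod.ext_iff.1 (Sum.inl_injective hr)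
      have h3 : b.1.2 = b'.1.2 := by
        rw [← h.choose_spec, ← h'.choose_spec, show h.choose = h'.choose from h2.1]
      rw [Subtype.ext (Prod.ext h2.2 h3)]
    · rw [row_inr_of_exists b h, row_inr_of_not_exists b' h'] at hr
      exact absurd hr Sum.inl_ne_inr
    · rw [row_inr_of_not_exists b h, row_inr_of_exists b' h'] at hr
      exact absurd hr Sum.inr_ne_inl
    · rw [row_inr_of_not_exists b h, row_inr_of_not_exists b' h'] at hr
      rw [Sum.inr_injective hr]

lemma exists_row_eq (hr : r ≤ N) : ∀ {k : ℕ} {l : ℕ} (i : (symMatrix N r k).Row) (j : Fin N),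
    1 ≤ l → l ≤ k + 1 →
    ((symMatrix N r k).entry i j = l ∨ (symMatrix N r k).entry i j = l + 1) →
    ∃ B : Block N r k, B.level = l ∧ B.row j = i
  | 0, l, _, _, h1, h2, _ => ⟨(), show 1 = l by omega, rfl⟩
  | k + 1, l, Sum.inl (t, i), j, h1, h2, h => by
    have h' : (symMatrix N r k).entry i (cyc t j) = l
      ∨ (symMatrix N r k).entry i (cyc t j) = l + 1 := h
    rcases Nat.lt_or_ge (k + 1) l with hl | hl
    · have := symMatrix_entry_le k i (cyc t j)
      have hb : (symMatrix N r k).entry i (cyc t j) = k + 2 := by omega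
      refine ⟨Sum.inr ⟨(i, cyc t j), hb⟩, show k + 2 = l by omega, ?_⟩
      -- `Block.row` picks some shift that reaches the entry; since `r ≤ N` it is unique, hence
      -- equal to `t`.
      have he : ∃ t' : Fin r, cyc (t' : ℕ) j = cyc t j := ⟨t, rfl⟩
      rw [row_inr_of_exists ⟨(i, cyc t j), hb⟩ he, cyc_left_injective hr j he.choose_spec]
    · obtain ⟨B, hB, hB'⟩ := exists_row_eq hr i (cyc t j) h1 hl h'
      exact ⟨Sum.inl (t, B), hB, congrArg (fun i => Sum.inl (t, i)) hB'⟩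
  | k + 1, l, Sum.inr b, j, h1, h2, h => by
    have h' : (if ∃ t : Fin r, cyc t j = b.1.2 then 0 else k + 2 + 1) = l
      ∨ (if ∃ t : Fin r, cyc t j = b.1.2 then 0 else k + 2 + 1) = l + 1 := h
    by_cases he : ∃ t : Fin r, cyc t j = b.1.2
    · rw [if_pos he] at h'
      omega
    · rw [if_neg he] at h'
      exact ⟨Sum.inr b, show k + 2 = l by omega, row_inr_of_not_exists b he⟩

end Block

lemma card_exists_cyc_eq (hr : r ≤ N) (c : Fin N) :
    (Finset.univ.filter fun j : Fin N => ∃ t : Fin r, cyc t j = c).card = r := by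
  choose f hf using fun t : Fin r => (cyc_bijective (N := N) t).2 c
  have h : (Finset.univ.filter fun j : Fin N => ∃ t : Fin r, cyc t j = c)
      = Finset.univ.image f := by
    ext j
    simp only [Finset.mem_filter, Finset.mem_univ, true_and, Finset.mem_image]
    refine exists_congr fun t => ⟨fun h => cyc_right_injective t ((hf t).trans h.symm), ?_⟩
    rintro rfl
    exact hf t
  rw [h, Finset.card_image_of_injective, Finset.card_univ, Fintype.card_fin]
  intro s t hst
  refine cyc_left_injective hr (f s) ((hf s).trans ?_)
  exact (hf t).symm.trans (by rw [hst])

/-- These `r` columns are the information set from which the interference of a block is decoded. -/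
lemma Block.card_level (hr : r ≤ N) : ∀ {k : ℕ} (B : Block N r k),
    (Finset.univ.filter fun j => (symMatrix N r k).entry (B.row j) j = B.level).card = r
  | 0, _ => by
    have h : (Finset.univ.filter fun j : Fin N => (if (j : ℕ) < r then 1 else 2) = 1)
        = Finset.univ.filter fun j : Fin N => (j : ℕ) < r :=
      Finset.filter_congr fun j _ => by split_ifs with h <;> simp [h]
    exact (congrArg Finset.card h).trans (by simp [Fin.card_filter_val_lt, hr])
  | k + 1, Sum.inl (t, g) => by
    refine Eq.trans ?_ (Block.card_level hr g)
    exact Finset.card_bijective (cyc t) (cyc_bijective (t : ℕ)) fun j => by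
      simp only [Finset.mem_filter, Finset.mem_univ, true_and]
      rfl
  | k + 1, Sum.inr b => by
    refine Eq.trans (congrArg Finset.card (Finset.filter_congr fun j _ => ?_))
      (card_exists_cyc_eq hr b.1.2)
    rw [Block.entry_row_inr]
    change _ = k + 2 ↔ _
    split_ifs with h <;> simp [h]

/-! ### Counting entries and queries. -/

lemma sum_lift (hr : r ≤ N) (k : ℕ) (S : SymMatrix N) (g : ℕ → ℕ) (g0 : g 0 = 0) :
    ∑ i, ∑ j, g ((S.lift r k).entry i j)
      = r * (∑ i, ∑ j, g (S.entry i j)) + Fintype.card (S.Cell k) * ((N - r) * g (k + 1)) := by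
  change ∑ x : (Fin r × S.Row) ⊕ S.Cell k, ∑ j, g ((S.lift r k).entry x j) = _
  rw [Fintype.sum_sum_type, Fintype.sum_prod_type]
  congr 1
  · have h (t : Fin r) (i : S.Row) : ∑ j, g ((S.lift r k).entry (Sum.inl (t, i)) j)
        = ∑ j, g (S.entry i j) :=
      Function.Bijective.sum_comp (cyc_bijective (N := N) t) fun j => g (S.entry i j)
    simp only [h, Finset.sum_const, Finset.card_univ, Fintype.card_fin, smul_eq_mul]
  · have h (b : S.Cell k) : ∑ j, g ((S.lift r k).entry (Sum.inr b) j) = (N - r) * g (k + 1) := by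
      have h1 (j : Fin N) : g ((S.lift r k).entry (Sum.inr b) j)
          = if ¬ ∃ t : Fin r, cyc t j = b.1.2 then g (k + 1) else 0 := by
        change g (if ∃ t : Fin r, cyc t j = b.1.2 then 0 else k + 1) = _
        split_ifs <;> simp_all
      rw [Finset.sum_congr rfl fun j _ => h1 j, ← Finset.sum_filter, Finset.sum_const, smul_eq_mul,
        Finset.filter_not, Finset.card_sdiff_of_subset (Finset.filter_subset _ _),
        card_exists_cyc_eq hr, Finset.card_univ, Fintype.card_fin]
    simp only [h, Finset.sum_const, Finset.card_univ, smul_eq_mul]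

lemma card_cell_eq_sum (S : SymMatrix N) (v : ℕ) :
    Fintype.card (S.Cell v) = ∑ i, ∑ j, if S.entry i j = v then 1 else 0 := by
  rw [Fintype.card_subtype, Finset.card_filter, Fintype.sum_prod_type]

/-- An arbitrary weight `g` serves all later counts at once. It also closes the induction: an
indicator weight gives the number of largest entries, which is the number of rows added by the next
lift. -/
lemma sum_symMatrix (hr : r ≤ N) (k : ℕ) : ∀ (g : ℕ → ℕ), g 0 = 0 →
    ∑ i, ∑ j, g ((symMatrix N r k).entry i j)
      = ∑ v ∈ Finset.range (k + 2), r ^ (k + 1 - v) * (N - r) ^ v * g (v + 1) := by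
  induction k with
  | zero =>
    intro g _
    change ∑ _i : Unit, ∑ j : Fin N, g (if (j : ℕ) < r then 1 else 2) = _
    have h (j : Fin N) : g (if (j : ℕ) < r then 1 else 2) = if (j : ℕ) < r then g 1 else g 2 := by
      split_ifs <;> rfl
    simp only [h, Finset.univ_unique, Finset.sum_const, Finset.card_singleton,
      Finset.sum_ite, Finset.sum_range_succ, Finset.sum_range_zero, smul_eq_mul]
    rw [Finset.filter_not, Finset.card_sdiff_of_subset (Finset.filter_subset _ _),
      Fin.card_filter_val_lt, Finset.card_univ, Fintype.card_fin, min_eq_right hr]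
    simp
  | succ k ih =>
    intro g g0
    have hc : Fintype.card ((symMatrix N r k).Cell (k + 2)) = (N - r) ^ (k + 1) := by
      rw [card_cell_eq_sum, ih (fun v => if v = k + 2 then 1 else 0) (by simp),
        Finset.sum_eq_single (k + 1)]
      · simp
      · intro b _ hb
        simp [hb]
      · simp
    refine (sum_lift hr (k + 2) (symMatrix N r k) g g0).trans ?_
    rw [hc, ih g g0, Finset.sum_range_succ _ (k + 2), Finset.mul_sum]
    congr 1
    · refine Finset.sum_congr rfl fun v hv => ?_
      rw [Finset.mem_range] at hv
      rw [show k + 1 + 1 - v = k + 1 - v + 1 by omega]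
      ring
    · rw [show k + 1 + 1 - (k + 2) = 0 by omega]
      ring

lemma card_finset_mem_card {M : ℕ} (m : Fin M) (v : ℕ) :
    Fintype.card {U : Finset (Fin M) // m ∈ U ∧ U.card = v + 1} = (M - 1).choose v := by
  have h : (Finset.univ.filter fun U : Finset (Fin M) => m ∈ U ∧ U.card = v + 1)
      = (Finset.powersetCard v (Finset.univ.erase m)).image (insert m) := by
    ext U
    simp only [Finset.mem_filter, Finset.mem_univ, true_and, Finset.mem_image,
      Finset.mem_powersetCard]
    constructor
    · rintro ⟨hm, hU⟩
      exact ⟨U.erase m, ⟨Finset.erase_subset_erase _ (Finset.subset_univ _), by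
        rw [Finset.card_erase_of_mem hm, hU, Nat.add_sub_cancel]⟩, Finset.insert_erase hm⟩
    · rintro ⟨V, ⟨hV, hc⟩, rfl⟩
      have hm : m ∉ V := fun h => Finset.notMem_erase _ _ (hV h)
      exact ⟨Finset.mem_insert_self _ _, by rw [Finset.card_insert_of_notMem hm, hc]⟩
  rw [Fintype.card_subtype, h, Finset.card_image_of_injOn, Finset.card_powersetCard,
    Finset.card_erase_of_mem (Finset.mem_univ _), Finset.card_univ, Fintype.card_fin]
  intro V hV V' hV' he
  have hm {W : Finset (Fin M)} (hW : W ∈ Finset.powersetCard v (Finset.univ.erase m)) : m ∉ W :=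
    fun h => Finset.notMem_erase _ _ ((Finset.mem_powersetCard.1 hW).1 h)
  rw [← Finset.erase_insert (hm hV), ← Finset.erase_insert (hm hV'), he]

lemma card_finset_nonempty_card {M : ℕ} (v : ℕ) :
    Fintype.card {U : Finset (Fin M) // U.Nonempty ∧ U.card = v + 1} = M.choose (v + 1) := by
  have h : (Finset.univ.filter fun U : Finset (Fin M) => U.Nonempty ∧ U.card = v + 1)
      = Finset.powersetCard (v + 1) Finset.univ := by
    ext U
    simp only [Finset.mem_filter, Finset.mem_univ, true_and, Finset.mem_powersetCard,
      Finset.subset_univ, and_iff_right_iff_imp]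
    intro hU
    exact Finset.card_pos.1 (by omega)
  rw [Fintype.card_subtype, h, Finset.card_powersetCard, Finset.card_univ, Fintype.card_fin]

/-- An entry `v + 1` gives `(M - 1).choose v` queries involving `m`, so the total is the binomial
expansion of `((N - r) + r) ^ (M - 1)`. It equals the message length, so the desired vectors form a
basis. -/
lemma card_desiredIdx (hr : r ≤ N) {M : ℕ} (hM : 2 ≤ M) (m : Fin M) :
    Fintype.card (DesiredIdx N r M m) = N ^ (M - 1) := by
  let e : DesiredIdx N r M m ≃ Σ i : (symMatrix N r (M - 2)).Row, Σ j : Fin N,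
      {U : Finset (Fin M) // m ∈ U ∧ U.card = (symMatrix N r (M - 2)).entry i j} :=
    { toFun := fun x => ⟨x.1.2.1.1, x.1.1, x.1.2.1.2, x.2, x.1.2.2.2⟩
      invFun := fun y => ⟨⟨y.2.1, (y.1, y.2.2.1), ⟨m, y.2.2.2.1⟩, y.2.2.2.2⟩, y.2.2.2.1⟩
      left_inv := fun _ => rfl
      right_inv := fun _ => rfl }
  rw [Fintype.card_congr e, Fintype.card_sigma]
  simp only [Fintype.card_sigma]
  rw [sum_symMatrix hr (M - 2)
    (fun v => Fintype.card {U : Finset (Fin M) // m ∈ U ∧ U.card = v})]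
  · simp only [card_finset_mem_card]
    obtain ⟨k, rfl⟩ : ∃ k, M = k + 2 := ⟨M - 2, by omega⟩
    calc _ = ((N - r) + r) ^ (k + 1) := by
          rw [add_pow]
          refine Finset.sum_congr rfl fun v _ => ?_
          simp only [Nat.add_sub_cancel, show k + 2 - 1 = k + 1 by omega, Nat.cast_id]
          ring
      _ = N ^ (k + 2 - 1) := by rw [Nat.sub_add_cancel hr]; rfl
  · rw [Fintype.card_eq_zero_iff]
    exact ⟨fun U => Finset.ne_empty_of_mem U.2.1 (Finset.card_eq_zero.1 U.2.2)⟩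

lemma sum_card_queryIdx (hr : r ≤ N) {M : ℕ} (hM : 2 ≤ M) :
    ∑ j, Fintype.card (QueryIdx N r M j)
      = ∑ v ∈ Finset.range M, r ^ (M - 1 - v) * (N - r) ^ v * M.choose (v + 1) := by
  have h (j : Fin N) : Fintype.card (QueryIdx N r M j) = ∑ i : (symMatrix N r (M - 2)).Row,
      Fintype.card {U : Finset (Fin M) //
        U.Nonempty ∧ U.card = (symMatrix N r (M - 2)).entry i j} := by
    let e : QueryIdx N r M j ≃ Σ i : (symMatrix N r (M - 2)).Row,
        {U : Finset (Fin M) // U.Nonempty ∧ U.card = (symMatrix N r (M - 2)).entry i j} :=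
      { toFun := fun x => ⟨x.1.1, x.1.2, x.2⟩
        invFun := fun y => ⟨(y.1, y.2.1), y.2.2⟩
        left_inv := fun _ => rfl
        right_inv := fun _ => rfl }
    rw [Fintype.card_congr e, Fintype.card_sigma]
  simp only [h]
  rw [Finset.sum_comm, sum_symMatrix hr (M - 2)
    (fun v => Fintype.card {U : Finset (Fin M) // U.Nonempty ∧ U.card = v})]
  · simp only [card_finset_nonempty_card]
    obtain ⟨k, rfl⟩ : ∃ k, M = k + 2 := ⟨M - 2, by omega⟩
    rfl
  · rw [Fintype.card_eq_zero_iff]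
    exact ⟨fun U => U.2.1.ne_empty (Finset.card_eq_zero.1 U.2.2)⟩

/-- The summand `r ^ M` is the term missing from the binomial expansion of `((N - r) + r) ^ M`, as
no query has an empty message set. -/
lemma sub_mul_sum_card_queryIdx (hr : r ≤ N) {M : ℕ} (hM : 2 ≤ M) :
    (N - r) * ∑ j, Fintype.card (QueryIdx N r M j) + r ^ M = N ^ M := by
  rw [sum_card_queryIdx hr hM]
  calc _ = ((N - r) + r) ^ M := by
        rw [add_pow, Finset.sum_range_succ', Finset.mul_sum]
        congr 1
        · refine Finset.sum_congr rfl fun v hv => ?_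
          rw [show M - (v + 1) = M - 1 - v by omega, pow_succ, Nat.cast_id]
          ring
        · simp
    _ = N ^ M := by rw [Nat.sub_add_cancel hr]

/-- Grouping message sets by size shows that each single server of the Sun–Jafar scheme gets as many
queries as all servers of the lifted scheme together. -/
lemma card_sunJafarQuery (hr : r ≤ N) {M : ℕ} (hM : 2 ≤ M) :
    Fintype.card (SunJafarQuery N r M) = N * ∑ j, Fintype.card (QueryIdx N r M j) := by
  rw [sum_card_queryIdx hr hM, Fintype.card_sigma]
  simp only [Fintype.card_sigma, Fintype.card_fin, Finset.sum_const, Finset.card_univ, smul_eq_mul]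
  congr 1
  rw [← Finset.sum_subtype (Finset.univ.filter Finset.Nonempty)
    (by simp) (fun U : Finset (Fin M) => r ^ (M - U.card) * (N - r) ^ (U.card - 1)),
    Finset.sum_filter]
  have h := Finset.sum_powerset_apply_card (x := (Finset.univ : Finset (Fin M)))
    (fun v => if v = 0 then 0 else r ^ (M - v) * (N - r) ^ (v - 1))
  rw [Finset.powerset_univ, Finset.card_univ, Fintype.card_fin, Finset.sum_range_succ'] at h
  refine (Finset.sum_congr rfl fun U _ => ?_).trans (h.trans ?_)
  · by_cases hU : U = ∅ <;> simp [hU, Finset.nonempty_iff_ne_empty]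
  · simp only [if_true, smul_zero, add_zero]
    refine Finset.sum_congr rfl fun v _ => ?_
    rw [if_neg (Nat.succ_ne_zero v), Nat.add_sub_cancel, smul_eq_mul,
      show M - (v + 1) = M - 1 - v by omega]
    ring

/-! ### Laws invariant under a transitive action. -/

section Probability

lemma map_uniform_apply_eq {α β : Type*} [Fintype α] [Nonempty α] (f : α → β) (e : α ≃ α)
    {a : β → β} (ha : Function.Injective a) (h : ∀ s, f (e s) = a (f s)) (x : β) :
    ((PMF.uniformOfFintype α).map f) (a x) = ((PMF.uniformOfFintype α).map f) x := by
  rw [PMF.map_apply, PMF.map_apply, ← e.tsum_eq]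
  refine tsum_congr fun s => ?_
  simp only [h, ha.eq_iff, PMF.uniformOfFintype_apply]

/-- Constancy gives `p x * p' y = p y * p' x`; summing over `y` replaces a computation of the size
of `O`. -/
lemma pmf_eq_of_constant_on {β : Type*} {p p' : PMF β} {O : Set β} (hp : p.support ⊆ O)
    (hp' : p'.support ⊆ O) (hc : ∀ x ∈ O, ∀ y ∈ O, p x = p y)
    (hc' : ∀ x ∈ O, ∀ y ∈ O, p' x = p' y) : p = p' := by
  ext x
  by_cases hx : x ∈ O
  · have h (y : β) : p x * p' y = p y * p' x := by
      by_cases hy : y ∈ O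
      · rw [hc x hx y hy, hc' x hx y hy]
      · rw [(PMF.apply_eq_zero_iff p y).2 fun h => hy (hp h),
          (PMF.apply_eq_zero_iff p' y).2 fun h => hy (hp' h), mul_zero, zero_mul]
    have h2 : ∑' y, p x * p' y = ∑' y, p y * p' x := tsum_congr h
    rwa [ENNReal.tsum_mul_left, ENNReal.tsum_mul_right, PMF.tsum_coe, PMF.tsum_coe, mul_one,
      one_mul] at h2
  · rw [(PMF.apply_eq_zero_iff p x).2 fun h => hx (hp h),
      (PMF.apply_eq_zero_iff p' x).2 fun h => hx (hp' h)]

end Probability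

/-! ### Linear algebra of independent families. -/

section LinearAlgebra

variable {F : Type} [Field F]

/-- The isomorphism of the two spans matching the families extends to the finite-dimensional space
`V`. This is the transitivity used for privacy. -/
lemma exists_linearEquiv_apply_eq {V ι : Type*} [AddCommGroup V] [Module F V]
    [FiniteDimensional F V] {v w : ι → V} (hv : LinearIndependent F v)
    (hw : LinearIndependent F w) : ∃ g : V ≃ₗ[F] V, ∀ i, g (v i) = w i := by
  obtain ⟨g, hg⟩ := Submodule.exists_linearEquiv_restrict_eq
    (hv.linearCombinationEquiv.symm ≪≫ₗ hw.linearCombinationEquiv)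
  refine ⟨g, fun i => ?_⟩
  have hvi : (hv.linearCombinationEquiv (Finsupp.single i 1) : V) = v i := by simp
  have hwi : (hw.linearCombinationEquiv (Finsupp.single i 1) : V) = w i := by simp
  rw [← hvi, ← hg, ← hwi]
  simp

lemma eq_zero_of_forall_sum_mul_eq_zero {ι : Type*} [Fintype ι] {n : ℕ} {v : ι → Fin n → F}
    (hv : LinearIndependent F v) (hc : Fintype.card ι = n) {z : Fin n → F}
    (h : ∀ i, ∑ t, z t * v i t = 0) : z = 0 := by
  have hs := hv.span_eq_top_of_card_eq_finrank' (by simpa using hc)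
  have hz : Fintype.linearCombination F z = 0 := by
    refine LinearMap.ext_on_range hs fun i => ?_
    simp only [Fintype.linearCombination_apply, smul_eq_mul, LinearMap.zero_apply]
    rw [← h i]
    exact Finset.sum_congr rfl fun t _ => mul_comm _ _
  funext t
  have := LinearMap.congr_fun hz (Pi.single t 1)
  simpa [Fintype.linearCombination_apply, Pi.single_apply] using this

lemma exists_linearIndependent {ι : Type*} [Fintype ι] {n : ℕ} (h : Fintype.card ι ≤ n) :
    ∃ v : ι → Fin n → F, LinearIndependent F v := by
  obtain ⟨e⟩ : Nonempty (ι ↪ Fin n) :=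
    Function.Embedding.nonempty_of_card_le (by simpa using h)
  exact ⟨_, (Pi.basisFun F (Fin n)).linearIndependent.comp e e.injective⟩

end LinearAlgebra

/-! ### Structure of the lifted queries. -/

section Lifted

variable {F : Type} [Field F] {N r M L : ℕ} {m m' : Fin M}

lemma finset_eq_of_erase_eq {α : Type*} [DecidableEq α] {U V : Finset α} {a : α} (h : U.erase a = V.erase a)
    (hc : U.card = V.card) : U = V := by
  by_cases hU : a ∈ U <;> by_cases hV : a ∈ V
  · rw [← Finset.insert_erase hU, h, Finset.insert_erase hV]
  · have h1 := Finset.card_erase_add_one hU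
    rw [h, Finset.erase_eq_of_notMem hV] at h1
    omega
  · have h1 := Finset.card_erase_add_one hV
    rw [← h, Finset.erase_eq_of_notMem hU] at h1
    omega
  · rwa [Finset.erase_eq_of_notMem hU, Finset.erase_eq_of_notMem hV] at h

instance noiseIdx_self_isEmpty : IsEmpty (NoiseIdx N r M m m) :=
  ⟨fun κ => κ.2.1 κ.2.2.1⟩

/-- The exact count is not needed, only room for independent vectors. The index `(B, U, t)` is sent
to a query in column `t` of block `B`, with message set `U` or `insert m U` according to the value
of the cell. Erasing `m` recovers `U`, whose size is the level of `B`, so the cell then determines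
`B`. -/
lemma card_noiseIdx_le (hr : r ≤ N) (hM : 2 ≤ M) (m m' : Fin M) :
    Fintype.card (NoiseIdx N r M m m') ≤ N ^ (M - 1) := by
  rw [← card_desiredIdx hr hM m']
  let U (κ : NoiseIdx N r M m m') : Finset (Fin M) :=
    if (symMatrix N r (M - 2)).entry (κ.1.1.row (Fin.castLE hr κ.1.2.2)) (Fin.castLE hr κ.1.2.2)
      = κ.1.1.level then κ.1.2.1 else insert m κ.1.2.1
  have hU (κ : NoiseIdx N r M m m') : m' ∈ U κ ∧ (U κ).card = (symMatrix N r (M - 2)).entry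
      (κ.1.1.row (Fin.castLE hr κ.1.2.2)) (Fin.castLE hr κ.1.2.2) := by
    simp only [U]
    split_ifs with h
    · exact ⟨κ.2.2.1, by rw [κ.2.2.2, h]⟩
    · refine ⟨Finset.mem_insert_of_mem κ.2.2.1, ?_⟩
      rw [Finset.card_insert_of_notMem κ.2.1, κ.2.2.2,
        (κ.1.1.entry_row (Fin.castLE hr κ.1.2.2)).resolve_left h]
  have hU' (κ : NoiseIdx N r M m m') : (U κ).erase m = κ.1.2.1 := by
    simp only [U]
    split_ifs with h
    · exact Finset.erase_eq_of_notMem κ.2.1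
    · exact Finset.erase_insert κ.2.1
  refine Fintype.card_le_of_injective (fun κ => (⟨⟨Fin.castLE hr κ.1.2.2,
    (κ.1.1.row (Fin.castLE hr κ.1.2.2), U κ), ⟨m', (hU κ).1⟩, (hU κ).2⟩, (hU κ).1⟩ :
      DesiredIdx N r M m')) ?_
  intro κ κ' h
  have h1 : (Fin.castLE hr κ.1.2.2) = Fin.castLE hr κ'.1.2.2 :=
    congrArg (fun y : DesiredIdx N r M m' => y.1.1) h
  have h2 : κ.1.1.row (Fin.castLE hr κ.1.2.2) = κ'.1.1.row (Fin.castLE hr κ'.1.2.2) :=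
    congrArg (fun y : DesiredIdx N r M m' => y.1.2.1.1) h
  have h3 : U κ = U κ' := congrArg (fun y : DesiredIdx N r M m' => y.1.2.1.2) h
  have h4 : κ.1.2.1 = κ'.1.2.1 := by rw [← hU', ← hU', h3]
  have h5 : κ.1.2.2 = κ'.1.2.2 := Fin.castLE_injective hr h1
  have h6 : κ.1.1 = κ'.1.1 := by
    refine Block.eq_of_row_eq (j := Fin.castLE hr κ'.1.2.2) ?_ ?_
    · rw [← κ.2.2.2, ← κ'.2.2.2, h4]
    · rw [← h2, h5]
  exact Subtype.ext (Prod.ext h6 (Prod.ext h4 h5))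

lemma nonempty_seed (hr : r ≤ N) (hM : 2 ≤ M) (m : Fin M) :
    Nonempty (Seed F N r M (N ^ (M - 1)) m) := by
  obtain ⟨a, ha⟩ := exists_linearIndependent (F := F) (card_desiredIdx hr hM m).le
  choose w hw using fun m' => exists_linearIndependent (F := F) (card_noiseIdx_le hr hM m m')
  exact ⟨⟨(a, w), ha, hw⟩⟩

variable {gen : Matrix (Fin N) (Fin r) F}

lemma liftedQueries_self (s : Seed F N r M L m) (j : Fin N) (x : QueryIdx N r M j) :
    liftedQueries gen M L m s j x m = if h : m ∈ x.1.2 then s.1.1 ⟨⟨j, x⟩, h⟩ else 0 := by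
  unfold liftedQueries
  rw [Finset.univ_eq_empty, Finset.sum_empty, add_zero]
  by_cases h : m ∈ x.1.2
  · rw [dif_pos h, dif_pos ⟨rfl, h⟩]
  · rw [dif_neg h, dif_neg fun h' => h h'.2]

lemma liftedQueries_of_ne (hm : m' ≠ m) (s : Seed F N r M L m) (j : Fin N)
    (x : QueryIdx N r M j) :
    liftedQueries gen M L m s j x m' = ∑ κ : NoiseIdx N r M m m',
      if κ.1.2.1 = x.1.2.erase m ∧ κ.1.1.row j = x.1.1 then gen j κ.1.2.2 • s.1.2 m' κ else 0 := by
  unfold liftedQueries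
  rw [dif_neg fun h => hm h.1, zero_add]

lemma liftedQueries_of_notMem (s : Seed F N r M L m) (j : Fin N) (x : QueryIdx N r M j)
    (hx : m' ∉ x.1.2) : liftedQueries gen M L m s j x m' = 0 := by
  by_cases hm : m' = m
  · subst hm
    rw [liftedQueries_self, dif_neg hx]
  · rw [liftedQueries_of_ne hm]
    refine Finset.sum_eq_zero fun κ _ => if_neg fun h => hx ?_
    exact Finset.mem_of_mem_erase (h.1 ▸ κ.2.2.1)

/-- A change of coordinates for each message acts on the randomness. -/
def Seed.transform (g : Fin M → (Fin L → F) ≃ₗ[F] (Fin L → F)) :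
    Seed F N r M L m ≃ Seed F N r M L m where
  toFun s := ⟨(fun x => g m (s.1.1 x), fun m' κ => g m' (s.1.2 m' κ)),
    s.2.1.map' (g m).toLinearMap (g m).ker, fun m' => (s.2.2 m').map' (g m').toLinearMap (g m').ker⟩
  invFun s := ⟨(fun x => (g m).symm (s.1.1 x), fun m' κ => (g m').symm (s.1.2 m' κ)),
    s.2.1.map' (g m).symm.toLinearMap (g m).symm.ker,
    fun m' => (s.2.2 m').map' (g m').symm.toLinearMap (g m').symm.ker⟩
  left_inv _ := Subtype.ext (Prod.ext (funext fun _ => (g m).symm_apply_apply _)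
    (funext fun m' => funext fun _ => (g m').symm_apply_apply _))
  right_inv _ := Subtype.ext (Prod.ext (funext fun _ => (g m).apply_symm_apply _)
    (funext fun m' => funext fun _ => (g m').apply_symm_apply _))

lemma liftedQueries_transform (g : Fin M → (Fin L → F) ≃ₗ[F] (Fin L → F))
    (s : Seed F N r M L m) (j : Fin N) (x : QueryIdx N r M j) (m' : Fin M) :
    liftedQueries gen M L m (Seed.transform g s) j x m'
      = g m' (liftedQueries gen M L m s j x m') := by
  by_cases hm : m' = m
  · subst hm
    rw [liftedQueries_self, liftedQueries_self]
    split_ifs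
    · rfl
    · rw [map_zero]
  · rw [liftedQueries_of_ne hm, liftedQueries_of_ne hm, map_sum]
    refine Finset.sum_congr rfl fun κ _ => ?_
    split_ifs
    · rw [map_smul]
      rfl
    · rw [map_zero]

lemma exists_block_of_queryIdx (hr : r ≤ N) (hM : 2 ≤ M) {j : Fin N} (x : QueryIdx N r M j)
    (hx : (x.1.2.erase m).Nonempty) : ∃ B : Block N r (M - 2),
      B.level = (x.1.2.erase m).card ∧ B.row j = x.1.1 := by
  have h1 := Finset.card_pos.2 hx
  have h2 : (x.1.2.erase m).card ≤ M - 1 := by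
    have := Finset.card_le_card (Finset.erase_subset_erase m (Finset.subset_univ x.1.2))
    rwa [Finset.card_erase_of_mem (Finset.mem_univ _), Finset.card_univ, Fintype.card_fin] at this
  refine Block.exists_row_eq hr x.1.1 j h1 (by omega) ?_
  rw [← x.2.2]
  by_cases h : m ∈ x.1.2
  · exact Or.inr (Finset.card_erase_add_one h).symm
  · exact Or.inl (by rw [Finset.erase_eq_of_notMem h])

/-- For an undesired message, a relation among the queries is first read off at each noise vector
and then collected within one codeword, where it becomes a relation among the rows of `gen` indexed
by `J`. -/
lemma linearIndependent_liftedQueries (hr : r ≤ N) (hM : 2 ≤ M) {J : Finset (Fin N)}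
    (hJ : LinearIndependent F (fun j : J => gen j)) (s : Seed F N r M L m) (m' : Fin M) :
    LinearIndependent F (fun y : {y : Σ j : J, QueryIdx N r M j // m' ∈ y.2.1.2} =>
      liftedQueries gen M L m s y.1.1 y.1.2 m') := by
  by_cases hm : m' = m
  · subst hm
    have h : (fun y : {y : Σ j : J, QueryIdx N r M j // m' ∈ y.2.1.2} =>
        liftedQueries gen M L m' s y.1.1 y.1.2 m')
        = s.1.1 ∘ fun y => ⟨⟨y.1.1, y.1.2⟩, y.2⟩ := by
      funext y
      rw [liftedQueries_self, dif_pos y.2]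
      rfl
    rw [h]
    refine s.2.1.comp _ ?_
    rintro ⟨⟨⟨j, hj⟩, x⟩, hx⟩ ⟨⟨⟨j', hj'⟩, x'⟩, hx'⟩ h
    have h' : (⟨j, x⟩ : Σ j, QueryIdx N r M j) = ⟨j', x'⟩ := congrArg Subtype.val h
    cases h'
    rfl
  · rw [Fintype.linearIndependent_iff]
    intro c hc y₀
    have h1 : ∑ κ : NoiseIdx N r M m m', (∑ y : {y : Σ j : J, QueryIdx N r M j // m' ∈ y.2.1.2},
        if κ.1.2.1 = y.1.2.1.2.erase m ∧ κ.1.1.row y.1.1 = y.1.2.1.1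
          then c y * gen y.1.1 κ.1.2.2 else 0) • s.1.2 m' κ = 0 := by
      rw [← hc]
      simp_rw [liftedQueries_of_ne hm, Finset.sum_smul, Finset.smul_sum]
      rw [Finset.sum_comm]
      refine Finset.sum_congr rfl fun y _ => Finset.sum_congr rfl fun κ _ => ?_
      split_ifs
      · rw [mul_smul]
      · rw [zero_smul, smul_zero]
    have h2 := Fintype.linearIndependent_iff.1 (s.2.2 m') _ h1
    have hm₀ : m' ∈ y₀.1.2.1.2.erase m := Finset.mem_erase.2 ⟨hm, y₀.2⟩
    obtain ⟨B, hB, hBrow⟩ := exists_block_of_queryIdx hr hM y₀.1.2 ⟨m', hm₀⟩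
    let p (y : {y : Σ j : J, QueryIdx N r M j // m' ∈ y.2.1.2}) : Prop :=
      y₀.1.2.1.2.erase m = y.1.2.1.2.erase m ∧ B.row y.1.1 = y.1.2.1.1
    -- Only queries carrying the same codeword as `y₀` are kept; coordinate `t` of this relation is
    -- the coefficient of the `t`-th noise vector of the codeword.
    have h3 : ∑ j : J, (∑ y, if y.1.1 = j ∧ p y then c y else 0) • gen j = 0 := by
      funext t
      rw [Finset.sum_apply, Pi.zero_apply]
      refine Eq.trans ?_ (h2 ⟨(B, y₀.1.2.1.2.erase m, t), Finset.notMem_erase _ _, hm₀, hB.symm⟩)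
      simp_rw [Pi.smul_apply, smul_eq_mul, Finset.sum_mul]
      rw [Finset.sum_comm]
      refine Finset.sum_congr rfl fun y _ => ?_
      by_cases hp : p y
      · refine Eq.trans ?_ (if_pos hp).symm
        simp [hp, ite_mul]
      · refine Eq.trans ?_ (if_neg hp).symm
        simp [hp]
    have h4 := Fintype.linearIndependent_iff.1 hJ _ h3 y₀.1.1
    rw [Finset.sum_eq_single y₀] at h4
    · rwa [if_pos ⟨rfl, rfl, hBrow⟩] at h4
    · intro y _ hy
      refine if_neg fun h => hy ?_
      obtain ⟨⟨j, x⟩, hx⟩ := y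
      obtain ⟨⟨j₀, x₀⟩, hx₀⟩ := y₀
      obtain ⟨rfl, hU, hrow⟩ := h
      have e1 : x.1.1 = x₀.1.1 := hrow.symm.trans hBrow
      -- The value of the cell fixes the size of the message set, and hence whether it contains `m`;
      -- so a codeword meets each server in only one query.
      have e2 : x.1.2 = x₀.1.2 := finset_eq_of_erase_eq hU.symm (by rw [x.2.2, x₀.2.2, e1])
      obtain rfl : x = x₀ := Subtype.ext (Prod.ext e1 e2)
      rfl
    · exact fun h => absurd (Finset.mem_univ _) h

end Lifted

/-! ### Privacy of the lifted scheme. -/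

section Privacy

variable {F : Type} [Field F] [Fintype F] {N r M : ℕ} {gen : Matrix (Fin N) (Fin r) F}

lemma refineLift_law (hr : r ≤ N) (hM : 2 ≤ M) (m : Fin M) :
    (refineLift gen M).law m =
      (@PMF.uniformOfFintype (Seed F N r M (N ^ (M - 1)) m) _ (nonempty_seed hr hM m)).map
        (liftedQueries gen M _ m) := dif_pos _

lemma refineLift_private (hr : r ≤ N) (hM : 2 ≤ M)
    (hgen : ∀ J : Finset (Fin N), J.card = r → LinearIndependent F (fun j : J => gen j)) :
    (refineLift gen M).toScheme.Private r := by
  intro J hJ m₁ m₂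
  let X := ∀ j : J, QueryIdx N r M j → LinQuery F M (N ^ (M - 1))
  -- The common orbit: its description does not refer to the desired message.
  let O : Set X := {q | ∀ m',
    LinearIndependent F (fun y : {y : Σ j : J, QueryIdx N r M j // m' ∈ y.2.1.2} =>
      q y.1.1 y.1.2 m') ∧ ∀ j x, m' ∉ x.1.2 → q j x m' = 0}
  let f (m : Fin M) (s : Seed F N r M (N ^ (M - 1)) m) : X :=
    fun j => liftedQueries gen M _ m s j
  have hlaw (m : Fin M) : ((refineLift gen M).toScheme.law m).map (fun q => fun j : J => q j)
      = (@PMF.uniformOfFintype (Seed F N r M (N ^ (M - 1)) m) _ (nonempty_seed hr hM m)).map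
        (f m) := by
    refine (congrArg (PMF.map _) (refineLift_law hr hM m)).trans ?_
    exact PMF.map_comp _ _ _
  have hO (m : Fin M) (s : Seed F N r M (N ^ (M - 1)) m) : f m s ∈ O := fun m' =>
    ⟨linearIndependent_liftedQueries hr hM (hgen J hJ) s m',
      fun j x hx => liftedQueries_of_notMem s j x hx⟩
  have hsupp (m : Fin M) : ((@PMF.uniformOfFintype (Seed F N r M (N ^ (M - 1)) m) _
      (nonempty_seed hr hM m)).map (f m)).support ⊆ O := by
    intro q hq
    obtain ⟨s, -, rfl⟩ := (PMF.mem_support_map_iff _ _ _).1 hq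
    exact hO m s
  have hconst (m : Fin M) : ∀ q ∈ O, ∀ q' ∈ O,
      ((@PMF.uniformOfFintype (Seed F N r M (N ^ (M - 1)) m) _
        (nonempty_seed hr hM m)).map (f m)) q =
      ((@PMF.uniformOfFintype (Seed F N r M (N ^ (M - 1)) m) _
        (nonempty_seed hr hM m)).map (f m)) q' := by
    intro q hq q' hq'
    have := nonempty_seed (F := F) hr hM m
    choose g hg using fun m' => exists_linearEquiv_apply_eq (hq m').1 (hq' m').1
    let a : X → X := fun q j x m' => g m' (q j x m')
    have ha : Function.Injective a := by
      intro q₁ q₂ h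
      funext j x m'
      exact (g m').injective (congrFun (congrFun (congrFun h j) x) m')
    have haq : a q = q' := by
      funext j x m'
      by_cases hx : m' ∈ x.1.2
      · exact hg m' ⟨⟨j, x⟩, hx⟩
      · change g m' (q j x m') = q' j x m'
        rw [(hq m').2 j x hx, (hq' m').2 j x hx, map_zero]
    rw [← haq]
    refine (map_uniform_apply_eq (f m) (Seed.transform g) ha (fun s => ?_) q).symm
    funext j x m'
    exact liftedQueries_transform g s j x m'
  exact (hlaw m₁).trans ((pmf_eq_of_constant_on (hsupp m₁) (hsupp m₂) (hconst m₁)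
    (hconst m₂)).trans (hlaw m₂).symm)

end Privacy

/-! ### Correctness of the lifted scheme. -/

section Correctness

variable {F : Type} [Field F] {N r M L : ℕ} {m : Fin M} {gen : Matrix (Fin N) (Fin r) F}

lemma response_sub (D D' : Database F M L) (q : LinQuery F M L) :
    response (D - D') q = response D q - response D' q := by
  simp only [response, Pi.sub_apply, sub_mul, Finset.sum_sub_distrib]

/-- The interference of the undesired messages in the response to a query of server `j`. -/
def interference (gen : Matrix (Fin N) (Fin r) F) (s : Seed F N r M L m) (D : Database F M L)
    (j : Fin N) (x : QueryIdx N r M j) : F :=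
  ∑ m' ∈ Finset.univ.erase m, ∑ i, D m' i * liftedQueries gen M L m s j x m' i

lemma response_liftedQueries (s : Seed F N r M L m) (D : Database F M L)
    (j : Fin N) (x : QueryIdx N r M j) :
    response D (liftedQueries gen M L m s j x)
      = ∑ i, D m i * liftedQueries gen M L m s j x m i + interference gen s D j x :=
  (Finset.add_sum_erase _ (fun m' => ∑ i, D m' i * liftedQueries gen M L m s j x m' i)
    (Finset.mem_univ m)).symm

/-- The vector of `r` symbols of which the interference in the block `B` with message set `U` is an
encoding. -/
def noiseWord (s : Seed F N r M L m) (D : Database F M L) (B : Block N r (M - 2))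
    (U : Finset (Fin M)) (hU : m ∉ U) (hB : B.level = U.card) (t : Fin r) : F :=
  ∑ m' ∈ Finset.univ.erase m, if h : m' ∈ U then
    ∑ i, D m' i * s.1.2 m' ⟨(B, U, t), hU, h, hB.symm⟩ i else 0

/-- By uniqueness of the block through a cell at a given level, only the noise vectors of `(B, U)`
contribute. -/
lemma interference_eq (s : Seed F N r M L m) (D : Database F M L) (B : Block N r (M - 2))
    (U : Finset (Fin M)) (hU : m ∉ U) (hB : B.level = U.card) (j : Fin N) (x : QueryIdx N r M j)
    (hx : x.1.2.erase m = U) (hxB : B.row j = x.1.1) :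
    interference gen s D j x = ∑ t, noiseWord s D B U hU hB t * gen j t := by
  unfold interference noiseWord
  simp_rw [Finset.sum_mul]
  refine Eq.trans (Finset.sum_congr rfl fun m' hm' => ?_) Finset.sum_comm
  by_cases hmU : m' ∈ U
  · let e (t : Fin r) : NoiseIdx N r M m m' := ⟨(B, U, t), hU, hmU, hB.symm⟩
    rw [liftedQueries_of_ne (Finset.ne_of_mem_erase hm'), hx]
    simp only [dif_pos hmU, Finset.sum_apply, Finset.mul_sum]
    rw [Finset.sum_comm]
    symm
    refine Fintype.sum_of_injective e ?_ _ _ ?_ ?_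
    · intro t t' h
      exact congrArg (fun κ : NoiseIdx N r M m m' => κ.1.2.2) h
    · intro κ hκ
      refine Finset.sum_eq_zero fun i _ => ?_
      rw [if_neg, Pi.zero_apply, mul_zero]
      rintro ⟨h1, h2⟩
      refine hκ ⟨κ.1.2.2, Subtype.ext (Prod.ext ?_ (Prod.ext h1.symm rfl))⟩
      exact Block.eq_of_row_eq (j := j) (by rw [hB, ← κ.2.2.2, h1]) (hxB.trans h2.symm)
    · intro t
      rw [Finset.sum_mul]
      refine Finset.sum_congr rfl fun i _ => ?_
      rw [if_pos ⟨rfl, hxB⟩, Pi.smul_apply, smul_eq_mul]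
      ring
  · rw [liftedQueries_of_notMem s j x fun h => hmU
      (hx ▸ Finset.mem_erase.2 ⟨Finset.ne_of_mem_erase hm', h⟩)]
    simp [hmU]

lemma interference_eq_zero (hr : r ≤ N) (hM : 2 ≤ M)
    (hgen : ∀ J : Finset (Fin N), J.card = r → LinearIndependent F (fun j : J => gen j))
    (s : Seed F N r M L m) (D : Database F M L)
    (hD : ∀ j x, response D (liftedQueries gen M L m s j x) = 0) (j : Fin N)
    (x : QueryIdx N r M j) : interference gen s D j x = 0 := by
  rcases (x.1.2.erase m).eq_empty_or_nonempty with he | hne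
  · refine Finset.sum_eq_zero fun m' hm' => ?_
    have hm : m' ≠ m := Finset.ne_of_mem_erase hm'
    rw [liftedQueries_of_notMem s j x fun h => Finset.notMem_empty m'
      (he ▸ Finset.mem_erase.2 ⟨hm, h⟩)]
    simp
  · obtain ⟨B, hB, hBrow⟩ := exists_block_of_queryIdx hr hM x hne
    have hU : m ∉ x.1.2.erase m := Finset.notMem_erase _ _
    have hz : noiseWord s D B _ hU hB = 0 := by
      refine eq_zero_of_forall_sum_mul_eq_zero (hgen _ (Block.card_level hr B))
        (by rw [Fintype.card_coe, Block.card_level hr B]) ?_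
      rintro ⟨j', hj'⟩
      have hj'' := (Finset.mem_filter.1 hj').2
      -- In a column where the block takes its smaller value, the set without `m` itself labels a
      -- query; its response is pure interference.
      let x' : QueryIdx N r M j' := ⟨(B.row j', x.1.2.erase m), hne, by rw [hj'', hB]⟩
      rw [← interference_eq s D B _ hU hB j' x' (Finset.erase_eq_of_notMem hU) rfl,
        ← hD j' x', response_liftedQueries, liftedQueries_of_notMem s j' x' hU]
      simp
    rw [interference_eq s D B _ hU hB j x rfl hBrow, hz]
    simp

lemma refineLift_correct [Fintype F] (hr : r ≤ N) (hM : 2 ≤ M)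
    (hgen : ∀ J : Finset (Fin N), J.card = r → LinearIndependent F (fun j : J => gen j)) :
    (refineLift gen M).toScheme.Correct := by
  intro m q hq D D' h
  have hq' : q ∈ ((@PMF.uniformOfFintype (Seed F N r M (N ^ (M - 1)) m) _
      (nonempty_seed hr hM m)).map (liftedQueries gen M _ m)).support := by
    rw [← refineLift_law hr hM m]
    exact hq
  obtain ⟨s, -, rfl⟩ := (PMF.mem_support_map_iff _ _ _).1 hq'
  have hD (j) (x : QueryIdx N r M j) :
      response (D - D') (liftedQueries gen M _ m s j x) = 0 := by
    rw [response_sub, sub_eq_zero]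
    exact congrFun (h j) x
  refine sub_eq_zero.1 (eq_zero_of_forall_sum_mul_eq_zero s.2.1 (card_desiredIdx hr hM m)
    (z := D m - D' m) ?_)
  rintro ⟨⟨j, x⟩, hx⟩
  have h1 := hD j x
  rw [response_liftedQueries, interference_eq_zero hr hM hgen s _ hD, add_zero,
    liftedQueries_self, dif_pos hx] at h1
  exact h1

end Correctness

/-! ### The one-shot scheme of a secret sharing scheme. -/

section OneShot

variable {F : Type} [Field F] {N T : ℕ}

lemma map_uniform_of_bijective {α β : Type*} [Fintype α] [Nonempty α] [Fintype β] [Nonempty β]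
    {f : α → β} (hf : Function.Bijective f) :
    (PMF.uniformOfFintype α).map f = PMF.uniformOfFintype β := by
  ext b
  obtain ⟨a, rfl⟩ := hf.2 b
  rw [PMF.map_apply, tsum_eq_single a, if_pos rfl, PMF.uniformOfFintype_apply,
    PMF.uniformOfFintype_apply, Fintype.card_of_bijective hf]
  intro a' ha
  exact if_neg fun h => ha (hf.1 h.symm)

/-- The masks determined by the randomness `ρ`. -/
def SecretSharing.masks (S : SecretSharing F N T) {V : Type*} [AddCommGroup V] [Module F V]
    (ρ : Fin T → V) (j : Fin N) : V := ∑ t, S.gen j t • ρ t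

/-- The rows of the generator for `T` servers are invertible. -/
lemma SecretSharing.exists_inverse (S : SecretSharing F N T) {J : Finset (Fin N)}
    (hJ : J.card = T) : ∃ C : Fin T → J → F, ∀ t t', ∑ j : J, C t j * S.gen j t'
      = if t' = t then 1 else 0 := by
  have hs := (S.mds J hJ).span_eq_top_of_card_eq_finrank' (by simp [hJ])
  have h (t : Fin T) : ∃ c : J → F, ∑ j, c j • S.gen j = Pi.single t 1 :=
    (Submodule.mem_span_range_iff_exists_fun F).1 (hs ▸ Submodule.mem_top)
  choose C hC using h
  refine ⟨C, fun t t' => ?_⟩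
  have := congrFun (hC t) t'
  rw [Finset.sum_apply, Pi.single_apply] at this
  exact this

lemma SecretSharing.eq_sum_masks (S : SecretSharing F N T) {J : Finset (Fin N)} {C : Fin T → J → F}
    (hC : ∀ t t', ∑ j : J, C t j * S.gen j t' = if t' = t then 1 else 0)
    {V : Type*} [AddCommGroup V] [Module F V] (ρ : Fin T → V) (t : Fin T) :
    ρ t = ∑ j : J, C t j • S.masks ρ j := by
  unfold SecretSharing.masks
  simp_rw [Finset.smul_sum, smul_smul]
  rw [Finset.sum_comm]
  simp_rw [← Finset.sum_smul, hC]
  simp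

/-- Any `T` masks determine `ρ`, and both sides have `|V| ^ T` elements. The offset `v` allows for
the information parts. -/
lemma SecretSharing.masks_bijective (S : SecretSharing F N T) {J : Finset (Fin N)}
    (hJ : J.card = T) {V : Type*} [AddCommGroup V] [Module F V] [Fintype V] (v : J → V) :
    Function.Bijective fun (ρ : Fin T → V) (j : J) => S.masks ρ j + v j := by
  rw [Fintype.bijective_iff_injective_and_card]
  constructor
  · intro ρ ρ' h
    obtain ⟨C, hC⟩ := S.exists_inverse hJ
    funext t
    rw [S.eq_sum_masks hC ρ t, S.eq_sum_masks hC ρ' t]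
    exact Finset.sum_congr rfl fun j _ => by rw [add_right_cancel (congrFun h j)]
  · simp [hJ]

lemma response_sum_smul {M L : ℕ} {ι : Type*} (s : Finset ι) (D : Database F M L) (c : ι → F)
    (q : ι → LinQuery F M L) :
    response D (∑ i ∈ s, c i • q i) = ∑ i ∈ s, c i * response D (q i) := by
  simp only [response, Finset.sum_apply, Pi.smul_apply, smul_eq_mul, Finset.mul_sum]
  rw [Finset.sum_comm' (t' := Finset.univ) (s' := fun _ => s) (by simp)]
  refine Finset.sum_congr rfl fun m _ => ?_
  rw [Finset.sum_comm]
  exact Finset.sum_congr rfl fun i _ => Finset.sum_congr rfl fun t _ => by ring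

lemma response_single {M L : ℕ} (m : Fin M) (i : Fin L) (q : LinQuery F M L) :
    response (Pi.single m (Pi.single i 1)) q = q m i := by
  unfold response
  rw [Finset.sum_eq_single m, Finset.sum_eq_single i]
  · simp
  · intro i' _ hi
    simp [hi]
  · exact fun h => absurd (Finset.mem_univ _) h
  · intro m' _ hm
    simp [hm]
  · exact fun h => absurd (Finset.mem_univ _) h

lemma SecretSharing.isOneShot [Fintype F] (S : SecretSharing F N T) (hTN : T < N) (M : ℕ) :
    IsOneShot (S.oneShotLaw M) T T := by
  intro m
  let a : Fin N → LinQuery F M (N - T) := fun j =>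
    if T ≤ (j : ℕ) then Pi.single m
      (fun i : Fin (N - T) => if (i : ℕ) = (j : ℕ) - T then (1 : F) else 0) else 0
  refine ⟨(PMF.uniformOfFintype (Fin T → LinQuery F M (N - T))).map S.masks, a, ?_, ?_, ?_, ?_, ?_,
    ?_⟩
  · rw [PMF.map_comp]
    rfl
  · intro j hj
    exact if_neg (not_le.2 hj)
  · intro j m' hm
    simp only [a]
    split_ifs
    · exact Pi.single_eq_of_ne hm _
    · rfl
  · intro J hJ
    refine (PMF.map_comp _ _ _).trans ?_
    exact map_uniform_of_bijective (S.masks_bijective hJ fun j : J => a j)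
  · rw [Fintype.linearIndependent_iff]
    rintro c hc ⟨j₀, hj₀⟩
    have hlt : (j₀ : ℕ) - T < N - T := by have := j₀.2; omega
    -- The test database with a single nonzero symbol isolates the coefficient of server `j₀`.
    have h1 := congrFun hc (Pi.single m (Pi.single ⟨(j₀ : ℕ) - T, hlt⟩ 1))
    rw [Finset.sum_apply, Pi.zero_apply, Finset.sum_eq_single ⟨j₀, hj₀⟩] at h1
    · rw [← h1]
      simp [response_single, a, hj₀]
    · rintro ⟨j, hj⟩ _ hne
      have : (j₀ : ℕ) - T ≠ (j : ℕ) - T := fun h => hne (Subtype.ext (Fin.ext (by simp; omega)))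
      simp [response_single, a, hj, this]
    · exact fun h => absurd (Finset.mem_univ _) h
  · set J : Finset (Fin N) := Finset.univ.filter fun i => (i : ℕ) < T with hJdef
    have hJ : J.card = T := by
      rw [hJdef, Fin.card_filter_val_lt, min_eq_right hTN.le]
    obtain ⟨C, hC⟩ := S.exists_inverse hJ
    -- Row `j` of the generator times the inverse of its first `T` rows.
    refine ⟨fun j i => if h : i ∈ J then ∑ t, S.gen j t * C t ⟨i, h⟩ else 0, ?_⟩
    intro q hq j _ D
    obtain ⟨ρ, -, rfl⟩ := (PMF.mem_support_map_iff _ _ _).1 hq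
    rw [← Finset.sum_coe_sort J, ← response_sum_smul]
    congr 1
    change ∑ t, S.gen j t • ρ t = _
    calc ∑ t, S.gen j t • ρ t = ∑ t, S.gen j t • ∑ i : J, C t i • S.masks ρ i :=
          Finset.sum_congr rfl fun t _ => by rw [← S.eq_sum_masks hC ρ t]
      _ = _ := by
          simp_rw [Finset.smul_sum, smul_smul]
          rw [Finset.sum_comm]
          refine Finset.sum_congr rfl fun i _ => ?_
          rw [dif_pos i.2, Finset.sum_smul]

end OneShot

/-! ### Rates of linear schemes and of the lifted scheme. -/

section Rates

variable {F : Type} [Field F] {N M L : ℕ}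

lemma LinearScheme.toScheme_rate (Q : LinearScheme F N M L) (hM : 1 ≤ M) :
    Q.toScheme.rate = Q.rate := by
  have h : Q.toScheme.download = Q.numQueries := by
    have : Nonempty (Fin M) := ⟨⟨0, hM⟩⟩
    have h1 (q) : Q.toScheme.downloadOf q = Q.numQueries := rfl
    unfold Scheme.download
    simp_rw [h1, ENNReal.tsum_mul_right, PMF.tsum_coe, one_mul]
    exact ciSup_const
  rw [Scheme.rate, h, ENNReal.toReal_div]
  rfl

variable [Fintype F] {T : ℕ}

lemma refineLift_rate (hTN : T < N) (hM : 2 ≤ M) (gen : Matrix (Fin N) (Fin T) F) :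
    (refineLift gen M).rate
      = (((N : ℝ) - T) * (N : ℝ) ^ (M - 1)) / ((N : ℝ) ^ M - (T : ℝ) ^ M) := by
  have hlt : (T : ℝ) < N := by exact_mod_cast hTN
  have hpow : (T : ℝ) ^ M < (N : ℝ) ^ M := pow_lt_pow_left₀ hlt (Nat.cast_nonneg _) (by omega)
  have h := congrArg (Nat.cast (R := ℝ)) (sub_mul_sum_card_queryIdx hTN.le hM)
  rw [Nat.cast_add, Nat.cast_mul, Nat.cast_sub hTN.le, Nat.cast_pow, Nat.cast_pow] at h
  have h2 : ((N : ℝ) - T) * (refineLift gen M).numQueries = (N : ℝ) ^ M - (T : ℝ) ^ M :=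
    eq_sub_of_add_eq h
  have h3 : (N : ℝ) - T ≠ 0 := (sub_pos.2 hlt).ne'
  rw [← h2, LinearScheme.rate, Nat.cast_pow, mul_div_mul_left _ _ h3]

end Rates

end PIR

end

theorem theorem3 {F : Type} [Field F] [Fintype F] (N T M : ℕ) (hT : 1 ≤ T) (hTN : T < N) (hM : 2 ≤ M)
    (S : PIR.SecretSharing F N T) :
    PIR.IsOneShot (S.oneShotLaw M) T T ∧
    (PIR.refineLift S.gen M).IsPIR T ∧
    (PIR.refineLift S.gen M).rate
      = (((N : ℝ) - T) * (N : ℝ) ^ (M - 1)) / ((N : ℝ) ^ M - (T : ℝ) ^ M) ∧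
    IsGreatest (PIR.achievableRates F N T M)
      ((((N : ℝ) - T) * (N : ℝ) ^ (M - 1)) / ((N : ℝ) ^ M - (T : ℝ) ^ M)) ∧
    (PIR.refineLift S.gen M).numQueries < Fintype.card (PIR.SunJafarQuery N T M) := by
  have hpir : (PIR.refineLift S.gen M).IsPIR T :=
    ⟨PIR.refineLift_correct hTN.le hM S.mds, PIR.refineLift_private hTN.le hM S.mds⟩
  have hrate := PIR.refineLift_rate hTN hM S.gen
  refine ⟨S.isOneShot hTN M, hpir, hrate, ⟨?_, ?_⟩, ?_⟩
  · exact ⟨N ^ (M - 1), Nat.one_le_pow _ _ (by omega), _, hpir,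
      (PIR.LinearScheme.toScheme_rate _ (by omega)).trans hrate⟩
  · rintro _ ⟨L, hL, P, hP, rfl⟩
    exact PIR.Scheme.rate_le hTN (by omega) hL hP
  · rw [PIR.card_sunJafarQuery hTN.le hM]
    -- The ratio of the query counts is `N`, which exceeds one; with no queries at all the counting
    -- identity would give `T ^ M = N ^ M`.
    refine lt_mul_left (Nat.pos_of_ne_zero fun h => ?_) (by omega)
    have h1 := PIR.sub_mul_sum_card_queryIdx hTN.le hM
    rw [show ∑ j, Fintype.card (PIR.QueryIdx N T M j) = 0 from h, mul_zero, zero_add] at h1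
    exact (Nat.pow_lt_pow_left hTN (by omega)).ne h1
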